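/- **Proposition (global translational order parameter and covariant differential).** Let $X$ be a smooth manifold, $\Pi\subset\mathbb R^d$ a full-rank lattice, $T_\Pi=\mathbb R^d/\Pi$, and let $P$ be a discrete group acting on the left on $T_\Pi$ by $\rho(p)[v]=[A_pv+a_p]$ with $A_p\in O(d)$ and $a_p\in\mathbb R^d$ (in the linear, or symmorphic, case $a_p=0$; in the nonsymmorphic case the action is that of the point group $P=\Gamma/\Pi$ of a crystallographic group $\Gamma$ with $\Gamma\cap\mathbb R^d=\Pi$, where $v\mapsto A_pv+a_p$ is a representative of $p$ in $\Gamma$). Then $p\mapsto A_p$ is a representation. Let $Q\to X$ be a fixed principal $P$-bundle, and put $$Y_\Pi=Q\times_PT_\Pi=(Q\times T_\Pi)/\big((q,\tau)\sim(qp,\rho(p^{-1})\tau)\big),\qquad Q\times_P\mathbb R^d=(Q\times\mathbb R^d)/\big((q,\xi)\sim(qp,A_p^{-1}\xi)\big).$$ Translational configurations are the smooth sections $\sigma$ of $\pi_Y:Y_\Pi\to X$. A local section $z_\alpha:U_\alpha\to Q$ over an open set $U_\alpha\subset X$ defines the admissible trivializations $[z_\alpha(x),\tau]\mapsto(x,\tau)$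 of $Y_\Pi|_{U_\alpha}$ and $[z_\alpha(x),\xi]\mapsto(x,\xi)$ of $(Q\times_P\mathbb R^d)|_{U_\alpha}$. Then the following hold. 1. $\pi_Y:Y_\Pi\to X$ is a smooth fibre bundle, and every admissible trivialization is a diffeomorphism $\pi_Y^{-1}(U_\alpha)\cong U_\alpha\times T_\Pi$. 2. There is a unique smooth Ehresmann connection $\Gamma_0$ on $\pi_Y$ whose horizontal distribution is $TU_\alpha\oplus0\subset T(U_\alpha\times T_\Pi)$ in every admissible trivialization. It is flat, that is, its horizontal distribution is involutive. 3. For every $y\in Y_\Pi$ there is a natural linear isomorphism $\Phi_y:(Q\times_P\mathbb R^d)_{\pi_Y(y)}\to V_yY_\Pi=\ker T_y\pi_Y$ such that, for $y=[q,[v]]$, $\Phi_y[q,\xi]=\frac{d}{dt}\big|_{t=0}[q,[v+t\xi]]$. 4. Let $\sigma$ be a smooth section of $Y_\Pi$. Its covariant differential $\nabla^{\Gamma_0}\sigma$, at $x$ the vertical part of $T_x\sigma:T_xX\to T_{\sigma(x)}Y_\Pi$ with respect to $\Gamma_0$, corresponds under $\Phi$ to a unique global section of $T^*X\otimes(Q\times_P\mathbb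 R^d)$, and this section is smooth. Near every point of $U_\alpha$, the representative $\sigma_\alpha$ of $\sigma$ (a map to $T_\Pi$) has a continuous lift $\widetilde u_\alpha$ to $\mathbb R^d$. Every continuous lift $\widetilde u_\alpha$ of $\sigma_\alpha$ on an open subset of $U_\alpha$ is smooth, and in the admissible trivialization $\nabla^{\Gamma_0}\sigma$ is represented there by the ordinary differential $d\widetilde u_\alpha$. 5. Let $z_\beta=z_\alpha g_{\alpha\beta}$ on $U_\alpha\cap U_\beta$, and let $\widetilde u_\alpha$, $\widetilde u_\beta$ be such lifts. On the intersection of their domains $\sigma_\beta=\rho(g_{\alpha\beta}^{-1})\sigma_\alpha$ and $$\widetilde u_\beta=A_{g_{\alpha\beta}}^{-1}\widetilde u_\alpha+a_{g_{\alpha\beta}^{-1}}+\lambda_{\alpha\beta},$$ where $g_{\alpha\beta}$ (hence the affine shift $a_{g_{\alpha\beta}^{-1}}$) and $\lambda_{\alpha\beta}$, with values in $P$ and $\Pi$, are locally constant. Consequently $$d\widetilde u_\beta=A_{g_{\alpha\beta}}^{-1}\,d\widetilde u_\alpha .$$ -/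

import Mathlib

open scoped Manifold ContDiff RightActions
open Bundle Set Topology

set_option linter.unusedSectionVars false

noncomputable section

namespace CrystalBundle

/-! ## The translation torus -/

/-- Euclidean space `ℝ^d`. -/
abbrev Euc (d : ℕ) : Type := EuclideanSpace ℝ (Fin d)

/-- The translation torus `ℝ^d / L` of a lattice `L`. -/
def Torus {d : ℕ} (L : Submodule ℤ (Euc d)) : Type := Euc d ⧸ L.toAddSubgroup

namespace Torus

section Basic

variable {d : ℕ} (L : Submodule ℤ (Euc d))

instance : AddCommGroup (Torus L) := inferInstanceAs (AddCommGroup (Euc d ⧸ L.toAddSubgroup))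

instance : TopologicalSpace (Torus L) :=
  inferInstanceAs (TopologicalSpace (Euc d ⧸ L.toAddSubgroup))

/-- The class `[v] ∈ ℝ^d / L` of a vector `v`. -/
def mk (v : Euc d) : Torus L := (QuotientAddGroup.mk v : Euc d ⧸ L.toAddSubgroup)

theorem mk_surjective : Function.Surjective (mk L) := QuotientAddGroup.mk_surjective

theorem mk_eq_mk {v w : Euc d} : mk L v = mk L w ↔ w - v ∈ L := by
  have := QuotientAddGroup.eq (s := L.toAddSubgroup) (a := v) (b := w)
  rw [neg_add_eq_sub] at this
  exact this

theorem continuous_mk : Continuous (mk L) := continuous_quot_mk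

theorem isQuotientMap_mk : IsQuotientMap (mk L) := isQuotientMap_quot_mk

variable [DiscreteTopology L]

theorem isLocalHomeomorph_mk : IsLocalHomeomorph (mk L) := by
  have h : IsDiscrete (L.toAddSubgroup : Set (Euc d)) := ⟨‹DiscreteTopology L›⟩
  exact (IsAddQuotientCoveringMap.isCoveringMap _ _
    (L.toAddSubgroup.isAddQuotientCoveringMap_of_comm h)).isLocalHomeomorph

/-- The smooth structure on the torus: its charts are the local inverses of the quotient map
`ℝ^d → ℝ^d / L`. -/
instance : ChartedSpace (Euc d) (Torus L) :=
  (isLocalHomeomorph_mk L).chartedSpace (mk_surjective L)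

variable {L}

theorem sub_eventuallyEq {f g : Euc d → Euc d} {v : Euc d} (hf : ContinuousAt f v)
    (hg : ContinuousAt g v) (h : ∀ᶠ w in 𝓝 v, mk L (f w) = mk L (g w)) :
    ∀ᶠ w in 𝓝 v, f w = g w + (f v - g v) := by
  obtain ⟨U, hU, hUL⟩ : ∃ U ∈ 𝓝 (0 : Euc d), ∀ x ∈ U, x ∈ L → x = 0 := by
    have h0 : ({0} : Set L) ∈ 𝓝 (0 : L) := by
      rw [discreteTopology_iff_singleton_mem_nhds] at *
      exact ‹∀ x : L, {x} ∈ 𝓝 x› 0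
    rw [nhds_subtype_eq_comap, Filter.mem_comap] at h0
    obtain ⟨U, hU, hs⟩ := h0
    refine ⟨U, hU, fun x hx hxL => ?_⟩
    have : (⟨x, hxL⟩ : L) ∈ ({0} : Set L) := hs hx
    simpa using congrArg Subtype.val this
  have hc : ContinuousAt (fun w => (f w - g w) - (f v - g v)) v :=
    (hf.sub hg).sub continuousAt_const
  have hmem : ∀ᶠ w in 𝓝 v, (f w - g w) - (f v - g v) ∈ U := by
    apply hc.eventually_mem
    simpa using hU
  filter_upwards [h, hmem] with w hw hwU
  have h1 := (mk_eq_mk L).1 hw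
  have h2 := (mk_eq_mk L).1 h.self_of_nhds
  have h3 := L.sub_mem h2 h1
  have h4 : g v - f v - (g w - f w) = (f w - g w) - (f v - g v) := by abel
  rw [h4] at h3
  have := hUL _ hwU h3
  rw [sub_eq_zero] at this
  rw [← this]; abel

theorem mk_chart {e : OpenPartialHomeomorph (Torus L) (Euc d)} (he : e ∈ atlas (Euc d) (Torus L))
    {t : Torus L} (ht : t ∈ e.source) : mk L (e t) = t := by
  obtain ⟨q, rfl⟩ := he
  simp only [chartAt_self_eq, OpenPartialHomeomorph.trans_refl] at ht ⊢
  exact (isLocalHomeomorph_mk L).apply_localInverseAt_of_mem ht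

theorem chart_symm {e : OpenPartialHomeomorph (Torus L) (Euc d)}
    (he : e ∈ atlas (Euc d) (Torus L)) (v : Euc d) : e.symm v = mk L v := by
  obtain ⟨q, rfl⟩ := he
  simp [chartAt_self_eq, OpenPartialHomeomorph.trans_refl]

theorem contDiffAt_of_mk_eq {f g : Euc d → Euc d} {v : Euc d} (hf : ContinuousAt f v)
    (hg : ContDiff ℝ ∞ g) (h : ∀ᶠ w in 𝓝 v, mk L (f w) = mk L (g w)) : ContDiffAt ℝ ∞ f v :=
  (hg.contDiffAt.add contDiffAt_const).congr_of_eventuallyEq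
    (sub_eventuallyEq hf hg.continuous.continuousAt h)

instance isManifold : IsManifold 𝓘(ℝ, Euc d) ∞ (Torus L) := by
  apply isManifold_of_contDiffOn
  intro e e' he he'
  simp only [modelWithCornersSelf_coe, modelWithCornersSelf_coe_symm, Function.id_comp,
    Function.comp_id, preimage_id, range_id, inter_univ]
  intro v hv
  refine (contDiffAt_of_mk_eq (L := L) (g := id) ?_ contDiff_id ?_).contDiffWithinAt
  · exact (e.symm.trans e').continuousAt hv
  · filter_upwards [(e.symm.trans e').open_source.mem_nhds hv] with w hw
    have hw' : e.symm w ∈ e'.source := by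
      rw [OpenPartialHomeomorph.trans_source] at hw
      exact hw.2
    simp only [OpenPartialHomeomorph.coe_trans, Function.comp_apply, id]
    rw [mk_chart he' hw', chart_symm he]

/-- A continuous self-map of the torus covered by a smooth map of `ℝ^d` is smooth. -/
theorem contMDiff_of_lift {F : Torus L → Torus L} {g : Euc d → Euc d} (hF : Continuous F)
    (hg : ContDiff ℝ ∞ g) (h : ∀ v, F (mk L v) = mk L (g v)) :
    ContMDiff 𝓘(ℝ, Euc d) 𝓘(ℝ, Euc d) ∞ F := by
  intro t
  rw [contMDiffAt_iff]
  refine ⟨hF.continuousAt, ContDiffAt.contDiffWithinAt ?_⟩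
  simp only [extChartAt, OpenPartialHomeomorph.extend, modelWithCornersSelf_partialEquiv,
    PartialEquiv.trans_refl, OpenPartialHomeomorph.toFun_eq_coe,
    OpenPartialHomeomorph.coe_toPartialEquiv_symm]
  set e := chartAt (Euc d) t
  set e' := chartAt (Euc d) (F t)
  have he : e ∈ atlas (Euc d) (Torus L) := chart_mem_atlas _ _
  have he' : e' ∈ atlas (Euc d) (Torus L) := chart_mem_atlas _ _
  have ht : t ∈ e.source := mem_chart_source _ _
  have ht' : F t ∈ e'.source := mem_chart_source _ _
  have hc : ContinuousAt (F ∘ e.symm) (e t) :=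
    hF.continuousAt.comp (e.symm.continuousAt (e.map_source ht))
  have hval : (F ∘ e.symm) (e t) ∈ e'.source := by simpa [e.left_inv ht] using ht'
  refine contDiffAt_of_mk_eq (L := L) (g := g) ?_ hg ?_
  · exact ContinuousAt.comp (g := e') (e'.continuousAt hval) hc
  · filter_upwards [hc.eventually_mem (e'.open_source.mem_nhds hval)] with w hw
    simp only [Function.comp_apply] at hw ⊢
    rw [mk_chart he' hw, chart_symm he, h]

end Basic

end Torus

/-! ## Affine actions of a group on the translation torus -/

/-- An action of a group `P` on the torus `ℝ^d / L` by affine isometries: every `p` acts by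
`[v] ↦ [A_p v + a_p]` with `A_p` orthogonal. The linear (symmorphic) case is `a_p = 0`. -/
structure AffineTorusAction (P : Type*) [Group P] {d : ℕ} (L : Submodule ℤ (Euc d)) where
  /-- the action on the torus -/
  act : P →* Equiv.Perm (Torus L)
  /-- the orthogonal part `A_p` -/
  lin : P → (Euc d ≃ₗᵢ[ℝ] Euc d)
  /-- the translational part `a_p`, a vector representing a class modulo `L` -/
  shift : P → Euc d
  act_mk : ∀ p v, act p (Torus.mk L v) = Torus.mk L (lin p v + shift p)

namespace AffineTorusAction

variable {P : Type*} [Group P] {d : ℕ} {L : Submodule ℤ (Euc d)}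

/-- The action by homeomorphisms of the torus. -/
def homeo (𝒜 : AffineTorusAction P L) : P →* (Torus L ≃ₜ Torus L) where
  toFun p :=
    { toEquiv := 𝒜.act p
      continuous_toFun := by
        refine (Torus.isQuotientMap_mk L).continuous_iff.2 ?_
        have : (𝒜.act p).toFun ∘ Torus.mk L = fun v => Torus.mk L (𝒜.lin p v + 𝒜.shift p) :=
          funext fun v => 𝒜.act_mk p v
        rw [this]
        exact (Torus.continuous_mk L).comp ((𝒜.lin p).continuous.add continuous_const)
      continuous_invFun := by
        refine (Torus.isQuotientMap_mk L).continuous_iff.2 ?_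
        have : (𝒜.act p).invFun ∘ Torus.mk L =
            fun v => Torus.mk L (𝒜.lin p⁻¹ v + 𝒜.shift p⁻¹) :=
          funext fun v => by
            rw [← 𝒜.act_mk p⁻¹ v, map_inv]; rfl
        rw [this]
        exact (Torus.continuous_mk L).comp ((𝒜.lin p⁻¹).continuous.add continuous_const) }
  map_one' := by ext t; simp
  map_mul' p q := by ext t; simp

@[simp] theorem homeo_mk (𝒜 : AffineTorusAction P L) (p : P) (v : Euc d) :
    𝒜.homeo p (Torus.mk L v) = Torus.mk L (𝒜.lin p v + 𝒜.shift p) := 𝒜.act_mk p v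

variable [DiscreteTopology L]

theorem contMDiff_homeo (𝒜 : AffineTorusAction P L) (p : P) :
    ContMDiff 𝓘(ℝ, Euc d) 𝓘(ℝ, Euc d) ∞ (𝒜.homeo p) :=
  Torus.contMDiff_of_lift (𝒜.homeo p).continuous
    ((𝒜.lin p).toContinuousLinearEquiv.contDiff.add contDiff_const) (𝒜.homeo_mk p)

/-- Two linear maps which agree modulo the lattice up to a constant are equal. -/
theorem lin_eq_of_mk_eq (S T : Euc d ≃ₗᵢ[ℝ] Euc d) (s t : Euc d)
    (h : ∀ v, Torus.mk L (S v + s) = Torus.mk L (T v + t)) : S = T := by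
  have h1 : ∀ᶠ w in 𝓝 (0 : Euc d), S w + s = (T w + t) + ((S 0 + s) - (T 0 + t)) :=
    Torus.sub_eventuallyEq (L := L) (f := fun w => S w + s) (g := fun w => T w + t)
      (by fun_prop) (by fun_prop) (Filter.Eventually.of_forall h)
  have h2 : ∀ᶠ w in 𝓝 (0 : Euc d), S w = T w := by
    filter_upwards [h1] with w hw
    simp only [map_zero, zero_add] at hw
    have : S w + s = T w + s := by rw [hw]; abel
    exact add_right_cancel this
  ext1 v
  have hc : Filter.Tendsto (fun n : ℝ => n • v) (𝓝[>] 0) (𝓝 0) := by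
    have : Continuous fun n : ℝ => n • v := by fun_prop
    simpa using (this.tendsto 0).mono_left nhdsWithin_le_nhds
  obtain ⟨n, hn, hpos⟩ := ((hc.eventually h2).and self_mem_nhdsWithin).exists
  simp only [map_smul] at hn
  exact smul_right_injective _ (ne_of_gt hpos) hn

/-- The linear part of an affine action is a representation `P → O(d)`. -/
def linHom (𝒜 : AffineTorusAction P L) : P →* (Euc d ≃ₗᵢ[ℝ] Euc d) :=
  MonoidHom.mk' 𝒜.lin fun p q => by
    refine lin_eq_of_mk_eq (L := L) _ _ (𝒜.shift (p * q)) (𝒜.lin p (𝒜.shift q) + 𝒜.shift p)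
      fun v => ?_
    rw [← 𝒜.act_mk, map_mul, Equiv.Perm.mul_apply, 𝒜.act_mk, 𝒜.act_mk, map_add, add_assoc]
    rfl

/-- The linear action on `ℝ^d` by homeomorphisms. -/
def linHomeo (𝒜 : AffineTorusAction P L) : P →* (Euc d ≃ₜ Euc d) where
  toFun p := (𝒜.linHom p).toHomeomorph
  map_one' := by ext1 v; simp
  map_mul' p q := by ext1 v; simp

@[simp] theorem linHomeo_apply (𝒜 : AffineTorusAction P L) (p : P) (v : Euc d) :
    𝒜.linHomeo p v = 𝒜.lin p v := rfl

end AffineTorusAction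

/-! ## The action of the point group of a crystallographic group -/

section SpaceGroup

variable {d : ℕ} (Γ : Subgroup (Euc d ≃ᵃⁱ[ℝ] Euc d))

/-- The lattice `L = Γ ∩ ℝ^d` of translation vectors of a group `Γ` of Euclidean motions. -/
def translationLattice : Submodule ℤ (Euc d) :=
  AddSubgroup.toIntSubmodule
    { carrier := {v | AffineIsometryEquiv.constVAdd ℝ (Euc d) v ∈ Γ}
      zero_mem' := by
        have h : AffineIsometryEquiv.constVAdd ℝ (Euc d) (0 : Euc d) = 1 := by ext1 x; simp
        rw [mem_ofPred_eq, h]; exact Γ.one_mem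
      add_mem' := fun {v w} hv hw => by
        have h : AffineIsometryEquiv.constVAdd ℝ (Euc d) (v + w) =
            AffineIsometryEquiv.constVAdd ℝ (Euc d) v *
              AffineIsometryEquiv.constVAdd ℝ (Euc d) w := by
          ext1 x; simp [add_assoc]
        rw [mem_ofPred_eq, h]; exact Γ.mul_mem hv hw
      neg_mem' := fun {v} hv => by
        have h : AffineIsometryEquiv.constVAdd ℝ (Euc d) (-v) =
            (AffineIsometryEquiv.constVAdd ℝ (Euc d) v)⁻¹ := by
          rw [eq_inv_iff_mul_eq_one]; ext1 x; simp
        rw [mem_ofPred_eq, h]; exact Γ.inv_mem hv }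

theorem mem_translationLattice {v : Euc d} :
    v ∈ translationLattice Γ ↔ AffineIsometryEquiv.constVAdd ℝ (Euc d) v ∈ Γ := Iff.rfl

theorem motion_apply (g : Euc d ≃ᵃⁱ[ℝ] Euc d) (v : Euc d) :
    g v = g.linearIsometryEquiv v + g 0 := by
  have := g.map_vadd 0 v
  simpa using this

/-- The orthogonal part of a motion in `Γ`, as a homomorphism. -/
def orthogonalPart : Γ →* (Euc d ≃ₗᵢ[ℝ] Euc d) :=
  MonoidHom.mk' (fun g => g.1.linearIsometryEquiv) fun _ _ => rfl

/-- The point group `P = Γ / L`, that is, `Γ` modulo its translations. -/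
abbrev PointGroup : Type := Γ ⧸ (orthogonalPart Γ).ker

theorem lin_mem_translationLattice (g : Γ) {v : Euc d} (hv : v ∈ translationLattice Γ) :
    g.1.linearIsometryEquiv v ∈ translationLattice Γ := by
  rw [mem_translationLattice] at hv ⊢
  have h : AffineIsometryEquiv.constVAdd ℝ (Euc d) (g.1.linearIsometryEquiv v) =
      g.1 * AffineIsometryEquiv.constVAdd ℝ (Euc d) v * (g.1)⁻¹ := by
    rw [eq_mul_inv_iff_mul_eq]
    ext1 x
    have := g.1.map_vadd x v
    simpa using this.symm
  rw [h]
  exact Γ.mul_mem (Γ.mul_mem g.2 hv) (Γ.inv_mem g.2)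

/-- `Γ` acts on the torus `ℝ^d / L` by `[v] ↦ [g v]`. -/
def motionMap (g : Γ) : Torus (translationLattice Γ) → Torus (translationLattice Γ) :=
  Quotient.lift (fun v => Torus.mk _ (g.1 v)) (by
    intro v w h
    have h' : w - v ∈ translationLattice Γ := (Torus.mk_eq_mk _).1 (Quotient.sound h)
    rw [Torus.mk_eq_mk, motion_apply g.1 w, motion_apply g.1 v, add_sub_add_right_eq_sub,
      ← map_sub]
    exact lin_mem_translationLattice Γ g h')

theorem motionMap_mk (g : Γ) (v : Euc d) : motionMap Γ g (Torus.mk _ v) = Torus.mk _ (g.1 v) := rfl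

/-- The action of `Γ` on the torus as a homomorphism. -/
def motionAct : Γ →* Equiv.Perm (Torus (translationLattice Γ)) where
  toFun g :=
    { toFun := motionMap Γ g
      invFun := motionMap Γ g⁻¹
      left_inv := fun t => by
        obtain ⟨v, rfl⟩ := Torus.mk_surjective _ t
        simp [motionMap_mk]
      right_inv := fun t => by
        obtain ⟨v, rfl⟩ := Torus.mk_surjective _ t
        simp [motionMap_mk] }
  map_one' := by
    ext t
    obtain ⟨v, rfl⟩ := Torus.mk_surjective _ t
    rfl
  map_mul' g h := by
    ext t
    obtain ⟨v, rfl⟩ := Torus.mk_surjective _ t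
    rfl

/-- The action `p [v] = [A_p v + a_p]` of the point group of `Γ` on the torus, where
`v ↦ A_p v + a_p` is a representative in `Γ` of `p`. -/
def pointGroupAction : AffineTorusAction (PointGroup Γ) (translationLattice Γ) where
  act := QuotientGroup.lift (orthogonalPart Γ).ker (motionAct Γ) (by
    intro g hg
    have hg' : g.1.linearIsometryEquiv = 1 := hg
    have h0 : g.1 0 ∈ translationLattice Γ := by
      rw [mem_translationLattice]
      have : AffineIsometryEquiv.constVAdd ℝ (Euc d) (g.1 0) = g.1 := by
        ext1 x
        rw [motion_apply g.1 x, hg']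
        simp [add_comm]
      rw [this]; exact g.2
    ext t
    obtain ⟨v, rfl⟩ := Torus.mk_surjective _ t
    change Torus.mk _ (g.1 v) = Torus.mk _ v
    rw [eq_comm, Torus.mk_eq_mk, motion_apply g.1 v, hg']
    simpa using h0)
  lin p := (Quotient.out p).1.linearIsometryEquiv
  shift p := (Quotient.out p).1 0
  act_mk p v := by
    obtain ⟨g, hg⟩ : ∃ g, g = Quotient.out p := ⟨_, rfl⟩
    have hp : p = QuotientGroup.mk g := by rw [hg]; exact (QuotientGroup.out_eq' p).symm
    rw [← hg, ← motion_apply, hp]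
    rfl

end SpaceGroup

/-! ## Principal bundles with discrete structure group and their associated bundles -/

/-- A principal `P`-bundle over `X` with discrete structure group `P`: a space with a right action
of `P` (written `q <• p`) which is locally `P`-equivariantly isomorphic to `U × P`. -/
structure PrincipalBundle (P : Type*) [Group P] [TopologicalSpace P] (X : Type*)
    [TopologicalSpace X] where
  /-- the total space `Q` -/
  Total : Type*
  [topTotal : TopologicalSpace Total]
  [actTotal : MulAction Pᵐᵒᵖ Total]
  /-- the projection `Q → X` -/
  proj : Total → X
  proj_smul : ∀ (q : Total) (p : P), proj (q <• p) = proj q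
  exists_triv : ∀ x : X, ∃ e : Trivialization P proj, x ∈ e.baseSet ∧
    ∀ q : Total, proj q ∈ e.baseSet → ∀ p : P, (e (q <• p)).2 = (e q).2 * p

attribute [instance] PrincipalBundle.topTotal PrincipalBundle.actTotal

namespace PrincipalBundle

section Basic

variable {P : Type*} [Group P] [TopologicalSpace P] {X : Type*}
  [TopologicalSpace X] (B : PrincipalBundle P X)

/-- A continuous section `z` of `Q` over an open set `U` of `X`, that is, a local crystalline frame.
Values of `z` outside `U` are irrelevant. -/
structure LocalSection where
  /-- the open set `U` -/
  baseSet : Set X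
  isOpen_baseSet : IsOpen baseSet
  /-- the section `z` -/
  toFun : X → B.Total
  continuousOn_toFun : ContinuousOn toFun baseSet
  proj_toFun : ∀ x ∈ baseSet, B.proj (toFun x) = x

instance : CoeFun B.LocalSection (fun _ => X → B.Total) := ⟨LocalSection.toFun⟩

variable {B}

theorem existsUnique_smul {q q' : B.Total} (h : B.proj q = B.proj q') :
    ∃! p : P, q' = q <• p := by
  obtain ⟨e, hx, he⟩ := B.exists_triv (B.proj q)
  have hq : q ∈ e.source := e.mem_source.2 hx
  have hq' : q' ∈ e.source := e.mem_source.2 (h ▸ hx)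
  have hs : ∀ p : P, q <• p ∈ e.source := fun p => e.mem_source.2 (by rwa [B.proj_smul])
  refine ⟨(e q).2⁻¹ * (e q').2, ?_, fun p hp => ?_⟩
  · apply e.injOn hq' (hs _)
    refine Prod.ext ?_ ?_
    · exact (e.coe_fst hq').trans (by rw [← h, ← B.proj_smul q, ← e.coe_fst (hs _)]; rfl)
    · exact (by rw [he q hx]; group : (e q').2 = (e (q <• ((e q).2⁻¹ * (e q').2))).2)
  · subst hp
    rw [he q hx]; group

open Classical in
/-- The element `p` of `P` with `q' = q <• p`, for `q` and `q'` in the same fibre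
(and `1` otherwise). -/
def div (q q' : B.Total) : P :=
  if h : B.proj q = B.proj q' then (existsUnique_smul h).choose else 1

theorem smul_div {q q' : B.Total} (h : B.proj q = B.proj q') : q <• (div q q') = q' := by
  rw [div, dif_pos h]
  exact (existsUnique_smul h).choose_spec.1.symm

theorem div_eq {q q' : B.Total} {p : P} (hp : q' = q <• p) : div q q' = p := by
  have h : B.proj q = B.proj q' := by rw [hp, B.proj_smul]
  exact (existsUnique_smul h).unique (smul_div h).symm hp

theorem continuous_proj : Continuous B.proj := by
  rw [continuous_iff_continuousAt]
  intro q
  obtain ⟨e, hx, -⟩ := B.exists_triv (B.proj q)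
  exact e.continuousAt_proj (e.mem_source.2 hx)

theorem isOpenMap_proj : IsOpenMap B.proj := by
  rw [isOpenMap_iff_nhds_le]
  intro q
  obtain ⟨e, hx, -⟩ := B.exists_triv (B.proj q)
  exact (e.map_proj_nhds (e.mem_source.2 hx)).ge

variable [DiscreteTopology P]

theorem continuous_smul_right (p : P) : Continuous fun q : B.Total => q <• p := by
  rw [continuous_iff_continuousAt]
  intro q
  obtain ⟨e, hx, he⟩ := B.exists_triv (B.proj q)
  have hq : q ∈ e.source := e.mem_source.2 hx
  have hqp : q <• p ∈ e.source := e.mem_source.2 (by rwa [B.proj_smul])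
  have hev : (fun q' : B.Total => q' <• p) =ᶠ[𝓝 q]
      fun q' => e.toOpenPartialHomeomorph.symm ((e q').1, (e q').2 * p) := by
    filter_upwards [e.open_source.mem_nhds hq] with q' hq'
    have hb : B.proj q' ∈ e.baseSet := e.mem_source.1 hq'
    have h1 : q' <• p ∈ e.source := e.mem_source.2 (by rwa [B.proj_smul])
    have h2 : e (q' <• p) = ((e q').1, (e q').2 * p) := by
      ext
      · rw [e.coe_fst h1, e.coe_fst hq', B.proj_smul]
      · rw [he q' hb]
    rw [← h2]
    exact (e.left_inv h1).symm
  refine ContinuousAt.congr ?_ hev.symm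
  have hc : ContinuousAt e q := e.continuousAt hq
  have hm : ContinuousAt (fun q' => ((e q').1, (e q').2 * p)) q :=
    hc.fst.prodMk ((continuous_of_discreteTopology (f := fun r : P => r * p)).continuousAt.comp
      hc.snd)
  refine ContinuousAt.comp (g := e.toOpenPartialHomeomorph.symm) ?_ hm
  apply e.toOpenPartialHomeomorph.symm.continuousAt
  rw [OpenPartialHomeomorph.symm_source, e.target_eq]
  exact ⟨by rw [e.coe_fst hq]; exact hx, trivial⟩

theorem continuousOn_div {T : Type*} [TopologicalSpace T] {s : Set T} {f g : T → B.Total}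
    (hf : ContinuousOn f s) (hg : ContinuousOn g s) (h : ∀ t ∈ s, B.proj (f t) = B.proj (g t)) :
    ContinuousOn (fun t => div (f t) (g t)) s := by
  intro t ht
  obtain ⟨e, hx, he⟩ := B.exists_triv (B.proj (f t))
  have hft : f t ∈ e.source := e.mem_source.2 hx
  have hgt : g t ∈ e.source := e.mem_source.2 (h t ht ▸ hx)
  have hev : (fun t => div (f t) (g t)) =ᶠ[𝓝[s] t] fun t => (e (f t)).2⁻¹ * (e (g t)).2 := by
    filter_upwards [(hf t ht).eventually_mem (e.open_source.mem_nhds hft), self_mem_nhdsWithin]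
      with t' h1 h2
    have h3 := he (f t') (e.mem_source.1 h1) (div (f t') (g t'))
    rw [smul_div (h t' h2)] at h3
    rw [h3]; group
  refine ContinuousWithinAt.congr_of_eventuallyEq ?_ hev (hev.self_of_nhdsWithin ht)
  have c1 : ContinuousWithinAt (fun t => (e (f t)).2) s t :=
    ((e.continuousAt hft).comp_continuousWithinAt (hf t ht)).snd
  have c2 : ContinuousWithinAt (fun t => (e (g t)).2) s t :=
    ((e.continuousAt hgt).comp_continuousWithinAt (hg t ht)).snd
  exact (continuous_of_discreteTopology (f := fun r : P × P => r.1⁻¹ * r.2)).continuousAt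
    |>.comp_continuousWithinAt (c1.prodMk c2)

theorem exists_localSection (x : X) : ∃ z : B.LocalSection, x ∈ z.baseSet := by
  obtain ⟨e, hx, -⟩ := B.exists_triv x
  have hm : ∀ y ∈ e.baseSet, (y, (1 : P)) ∈ e.target := fun y hy => by
    rw [e.target_eq]; exact ⟨hy, trivial⟩
  refine ⟨⟨e.baseSet, e.open_baseSet, fun y => e.toOpenPartialHomeomorph.symm (y, 1), ?_, ?_⟩, hx⟩
  · exact e.toOpenPartialHomeomorph.symm.continuousOn.comp (by fun_prop) hm
  · intro y hy
    exact e.proj_symm_apply (hm y hy)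

variable (B) in
/-- A chosen local section of `Q` defined near `x`. -/
def sectionAt (x : X) : B.LocalSection := (exists_localSection (B := B) x).choose

theorem mem_sectionAt (x : X) : x ∈ (B.sectionAt x).baseSet :=
  (exists_localSection (B := B) x).choose_spec

theorem exists_proj_eq (x : X) : ∃ q : B.Total, B.proj q = x :=
  ⟨B.sectionAt x x, (B.sectionAt x).proj_toFun x (mem_sectionAt x)⟩

end Basic

section Assoc

variable {P : Type*} [Group P] [TopologicalSpace P] {X : Type*} [TopologicalSpace X]
  (B : PrincipalBundle P X) {F : Type*} [TopologicalSpace F] (ρ : P →* (F ≃ₜ F))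

/-- The equivalence relation `(q, f) ∼ (q p, ρ(p⁻¹) f)` on `Q × F`. -/
def assocSetoid : Setoid (B.Total × F) where
  r a b := ∃ p : P, b = (a.1 <• p, ρ p⁻¹ a.2)
  iseqv :=
    { refl := fun a => ⟨1, by simp⟩
      symm := by
        rintro a _ ⟨p, rfl⟩
        refine ⟨p⁻¹, ?_⟩
        simp [smul_smul]
      trans := by
        rintro a _ _ ⟨p, rfl⟩ ⟨p', rfl⟩
        exact ⟨p * p', by simp [smul_smul, ← MulOpposite.op_mul]⟩ }

/-- The associated bundle `Q ×_P F = (Q × F) / P`. -/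
def Assoc : Type _ := Quotient (B.assocSetoid ρ)

instance : TopologicalSpace (B.Assoc ρ) :=
  inferInstanceAs (TopologicalSpace (Quotient (B.assocSetoid ρ)))

namespace Assoc

/-- The class `[q, f]` in `Q ×_P F`. -/
def mk (q : B.Total) (f : F) : B.Assoc ρ := Quotient.mk (B.assocSetoid ρ) (q, f)

/-- The bundle projection `[q, f] ↦ π(q)`. -/
def proj : B.Assoc ρ → X :=
  Quotient.lift (s := B.assocSetoid ρ) (fun a => B.proj a.1) (by
    rintro a _ ⟨p, rfl⟩
    exact (B.proj_smul _ _).symm)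

variable {B ρ}

@[simp] theorem proj_mk (q : B.Total) (f : F) : proj B ρ (mk B ρ q f) = B.proj q := rfl

theorem exists_mk_eq (y : B.Assoc ρ) : ∃ q f, mk B ρ q f = y := by
  induction y using Quotient.inductionOn with
  | h a => exact ⟨a.1, a.2, rfl⟩

theorem mk_smul (q : B.Total) (p : P) (f : F) : mk B ρ (q <• p) f = mk B ρ q (ρ p f) := by
  refine (Quotient.sound (s := B.assocSetoid ρ) ⟨p, ?_⟩).symm
  simp

theorem mk_eq_mk_div {q q' : B.Total} (h : B.proj q = B.proj q') (f : F) :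
    mk B ρ q' f = mk B ρ q (ρ (div q q') f) := by
  rw [← mk_smul, smul_div h]

theorem mk_injective (q : B.Total) : Function.Injective (mk B ρ q) := by
  intro f f' h
  obtain ⟨p, hp⟩ := Quotient.exact (s := B.assocSetoid ρ) h
  obtain ⟨h1, h2⟩ := Prod.ext_iff.1 hp
  have hp1 : p = 1 := by
    have h3 : div q q = p := div_eq h1
    rw [← h3]
    exact div_eq (by simp)
  simp only [hp1, inv_one, map_one, Homeomorph.one_apply] at h2
  exact h2.symm

theorem continuous_mk : Continuous fun a : B.Total × F => mk B ρ a.1 a.2 := continuous_quot_mk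

theorem continuous_proj : Continuous (proj B ρ) :=
  (PrincipalBundle.continuous_proj.comp continuous_fst).quotient_lift _

variable [DiscreteTopology P]

theorem isOpenQuotientMap_mk : IsOpenQuotientMap fun a : B.Total × F => mk B ρ a.1 a.2 where
  surjective y := by
    obtain ⟨q, f, h⟩ := exists_mk_eq y
    exact ⟨(q, f), h⟩
  continuous := continuous_mk
  isOpenMap := by
    intro U hU
    have hq : IsQuotientMap fun a : B.Total × F => mk B ρ a.1 a.2 := isQuotientMap_quot_mk
    rw [← hq.isOpen_preimage]
    have : (fun a : B.Total × F => mk B ρ a.1 a.2) ⁻¹' ((fun a => mk B ρ a.1 a.2) '' U) =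
        ⋃ p : P, (fun a : B.Total × F => (a.1 <• p, ρ p⁻¹ a.2)) ⁻¹' U := by
      ext a
      simp only [mem_preimage, mem_image, mem_iUnion]
      constructor
      · rintro ⟨b, hb, hab⟩
        obtain ⟨p, hp⟩ := Quotient.exact (s := B.assocSetoid ρ) hab.symm
        exact ⟨p, by rw [← hp]; exact hb⟩
      · rintro ⟨p, hp⟩
        exact ⟨_, hp, (Quotient.sound (s := B.assocSetoid ρ) ⟨p, rfl⟩).symm⟩
    rw [this]
    exact isOpen_iUnion fun p => hU.preimage
      (((continuous_smul_right p).comp continuous_fst).prodMk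
        ((ρ p⁻¹).continuous.comp continuous_snd))

/-- The fibre coordinate with respect to a local section `z`: it sends `[z(x), f]` to `f`. -/
def coord (z : B.LocalSection) (y : B.Assoc ρ) : F :=
  ρ (div (z (proj B ρ y)) (Quotient.out y).1) (Quotient.out y).2

theorem mk_coord (z : B.LocalSection) {y : B.Assoc ρ} (hy : proj B ρ y ∈ z.baseSet) :
    mk B ρ (z (proj B ρ y)) (coord z y) = y := by
  have h1 : mk B ρ (Quotient.out y).1 (Quotient.out y).2 = y := Quotient.out_eq y
  have h2 : B.proj (Quotient.out y).1 = proj B ρ y := by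
    conv_rhs => rw [← h1]
    rfl
  rw [coord, ← mk_eq_mk_div (by rw [z.proj_toFun _ hy, h2]), h1]

theorem coord_mk (z : B.LocalSection) {q : B.Total} (hq : B.proj q ∈ z.baseSet) (f : F) :
    coord z (mk B ρ q f) = ρ (div (z (B.proj q)) q) f := by
  apply mk_injective (B := B) (ρ := ρ) (z (B.proj q))
  rw [← mk_eq_mk_div (z.proj_toFun _ hq)]
  exact mk_coord (ρ := ρ) z (y := mk B ρ q f) hq

theorem coord_mk_section (z : B.LocalSection) {x : X} (hx : x ∈ z.baseSet) (f : F) :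
    coord z (mk B ρ (z x) f) = f := by
  have h := z.proj_toFun x hx
  apply mk_injective (B := B) (ρ := ρ) (z x)
  have := mk_coord (ρ := ρ) z (y := mk B ρ (z x) f) (by simpa [h] using hx)
  simpa [h] using this

theorem continuousOn_coord (z : B.LocalSection) :
    ContinuousOn (coord (ρ := ρ) z) (proj B ρ ⁻¹' z.baseSet) := by
  have hopen : IsOpen (proj B ρ ⁻¹' z.baseSet) := z.isOpen_baseSet.preimage continuous_proj
  rw [isOpenQuotientMap_mk.isQuotientMap.continuousOn_isOpen_iff hopen]
  have hd : ContinuousOn (fun a : B.Total × F => div (z (B.proj a.1)) a.1)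
      ((fun a : B.Total × F => mk B ρ a.1 a.2) ⁻¹' (proj B ρ ⁻¹' z.baseSet)) := by
    refine continuousOn_div ?_ continuous_fst.continuousOn fun a ha => z.proj_toFun _ ha
    exact z.continuousOn_toFun.comp
      (PrincipalBundle.continuous_proj.comp continuous_fst).continuousOn fun a ha => ha
  intro a ha
  have hev : (coord (ρ := ρ) z ∘ fun a : B.Total × F => mk B ρ a.1 a.2)
      =ᶠ[𝓝[(fun a : B.Total × F => mk B ρ a.1 a.2) ⁻¹' (proj B ρ ⁻¹' z.baseSet)] a]
      fun b => ρ (div (z (B.proj a.1)) a.1) b.2 := by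
    filter_upwards [(hd a ha).eventually_mem ((isOpen_discrete {div (z (B.proj a.1)) a.1}).mem_nhds
      rfl), self_mem_nhdsWithin] with b hb hbs
    rw [Function.comp_apply, coord_mk z hbs, mem_singleton_iff.1 hb]
  refine ContinuousWithinAt.congr_of_eventuallyEq ?_ hev (hev.self_of_nhdsWithin ha)
  exact ((ρ _).continuous.comp continuous_snd).continuousWithinAt

/-- The admissible local trivialization of `Q ×_P F` defined by a local section `z` of `Q`:
`[z(x), f] ↦ (x, f)`. -/
def localTriv (z : B.LocalSection) : Trivialization F (proj B ρ) where
  toFun y := (proj B ρ y, coord z y)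
  invFun a := mk B ρ (z a.1) a.2
  source := proj B ρ ⁻¹' z.baseSet
  target := z.baseSet ×ˢ univ
  map_source' y hy := ⟨hy, trivial⟩
  map_target' a ha := by
    change B.proj (z a.1) ∈ z.baseSet
    rw [z.proj_toFun a.1 ha.1]; exact ha.1
  left_inv' y hy := mk_coord z hy
  right_inv' a ha := by
    ext
    · exact z.proj_toFun a.1 ha.1
    · exact coord_mk_section z ha.1 a.2
  open_source := z.isOpen_baseSet.preimage continuous_proj
  open_target := z.isOpen_baseSet.prod isOpen_univ
  continuousOn_toFun := continuous_proj.continuousOn.prodMk (continuousOn_coord z)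
  continuousOn_invFun :=
    continuous_mk.comp_continuousOn ((z.continuousOn_toFun.comp continuousOn_fst
      fun a ha => ha.1).prodMk continuousOn_snd)
  baseSet := z.baseSet
  open_baseSet := z.isOpen_baseSet
  source_eq := rfl
  target_eq := rfl
  proj_toFun y hy := rfl

end Assoc

end Assoc

end PrincipalBundle

namespace PrincipalBundle

/-! ### The torus bundle `Y = Q ×_P (ℝ^d / L)` as a smooth manifold -/

section TorusBundle

variable {P : Type*} [Group P] [TopologicalSpace P] [DiscreteTopology P] {X : Type*}
  [TopologicalSpace X] (B : PrincipalBundle P X) {d : ℕ} {L : Submodule ℤ (Euc d)}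
  (𝒜 : AffineTorusAction P L)

/-- The associated torus bundle `Y = Q ×_P (ℝ^d / L)`. -/
abbrev TorusBundle : Type _ := B.Assoc 𝒜.homeo

/-- The class `[q, [v]]` in `Q ×_P (ℝ^d / L)`. -/
def torusMk (q : B.Total) (v : Euc d) : B.TorusBundle 𝒜 := Assoc.mk B 𝒜.homeo q (Torus.mk L v)

variable {E : Type*} [NormedAddCommGroup E] [NormedSpace ℝ E] [ChartedSpace E X]
variable [DiscreteTopology L]

/-- The trivializations `[z(x), τ] ↦ (x, τ)`, regarded as charts of `Y` with values in
`X × ℝ^d / L`. -/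
@[reducible] def torusBundleTrivs : ChartedSpace (X × Torus L) (B.TorusBundle 𝒜) where
  atlas := range fun z : B.LocalSection =>
    (Assoc.localTriv (ρ := 𝒜.homeo) z).toOpenPartialHomeomorph
  chartAt y := (Assoc.localTriv (B.sectionAt (Assoc.proj B 𝒜.homeo y))).toOpenPartialHomeomorph
  mem_chart_source _ := mem_sectionAt _
  chart_mem_atlas _ := mem_range_self _

/-- The smooth structure of `Y`: charts are obtained from the admissible local trivializations
and the charts of `X` and of the torus. -/
instance instChartedSpaceTorusBundle :
    ChartedSpace (ModelProd E (Euc d)) (B.TorusBundle 𝒜) :=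
  letI := B.torusBundleTrivs 𝒜
  ChartedSpace.comp (ModelProd E (Euc d)) (X × Torus L) (B.TorusBundle 𝒜)

variable [IsManifold 𝓘(ℝ, E) ∞ X]

variable {B} in
theorem contMDiffOn_transition (z z' : B.LocalSection) :
    ContMDiffOn (𝓘(ℝ, E).prod 𝓘(ℝ, Euc d)) (𝓘(ℝ, E).prod 𝓘(ℝ, Euc d)) ∞
      (fun a : X × Torus L => (a.1, 𝒜.homeo (div (z' a.1) (z a.1)) a.2))
      ((z.baseSet ∩ z'.baseSet) ×ˢ univ) := by
  intro a ha
  have hd : ContinuousOn (fun x => div (z' x) (z x)) (z.baseSet ∩ z'.baseSet) :=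
    continuousOn_div (z'.continuousOn_toFun.mono inter_subset_right)
      (z.continuousOn_toFun.mono inter_subset_left)
      fun x hx => by rw [z.proj_toFun x hx.1, z'.proj_toFun x hx.2]
  have hd' : ContinuousOn (fun b : X × Torus L => div (z' b.1) (z b.1))
      ((z.baseSet ∩ z'.baseSet) ×ˢ univ) := hd.comp continuousOn_fst fun b hb => hb.1
  have hev := (hd' a ha).eventually_mem
    ((isOpen_discrete {div (z' a.1) (z a.1)}).mem_nhds rfl)
  have h1 : ContMDiffWithinAt (𝓘(ℝ, E).prod 𝓘(ℝ, Euc d)) (𝓘(ℝ, E).prod 𝓘(ℝ, Euc d)) ∞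
      (fun b : X × Torus L => (b.1, 𝒜.homeo (div (z' a.1) (z a.1)) b.2))
      ((z.baseSet ∩ z'.baseSet) ×ˢ univ) a :=
    (contMDiff_fst.prodMk ((𝒜.contMDiff_homeo _).comp contMDiff_snd)).contMDiffAt.contMDiffWithinAt
  refine h1.congr_of_eventuallyEq ?_ rfl
  filter_upwards [hev] with b hb
  rw [mem_singleton_iff.1 hb]

instance instIsManifoldTorusBundle :
    IsManifold (𝓘(ℝ, E).prod 𝓘(ℝ, Euc d)) ∞ (B.TorusBundle 𝒜) := by
  apply isManifold_of_contDiffOn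
  rintro _ _ ⟨_, ⟨z, rfl⟩, c, hc, rfl⟩ ⟨_, ⟨z', rfl⟩, c', hc', rfl⟩
  rw [← contMDiffOn_iff_contDiffOn]
  set J := 𝓘(ℝ, E).prod 𝓘(ℝ, Euc d)
  have hI : ContMDiff J 𝓘(ℝ, E × Euc d) ∞ J := J.contMDiff
  have hc1 := contMDiffOn_symm_of_mem_maximalAtlas (n := ∞)
    (IsManifold.subset_maximalAtlas (I := J) hc)
  have hc2 := contMDiffOn_of_mem_maximalAtlas (n := ∞)
    (IsManifold.subset_maximalAtlas (I := J) hc')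
  have hIs : ContMDiffOn 𝓘(ℝ, E × Euc d) J ∞ J.symm (range J) := J.contMDiffOn_symm
  have ht := contMDiffOn_transition (E := E) 𝒜 z z'
  intro a ha
  obtain ⟨ha, har⟩ := ha
  set e := (Assoc.localTriv (ρ := 𝒜.homeo) z).toOpenPartialHomeomorph
  set e' := (Assoc.localTriv (ρ := 𝒜.homeo) z').toOpenPartialHomeomorph
  set S := ((e.trans c).symm.trans (e'.trans c')).source
  set b : ModelProd E (Euc d) := J.symm a
  have hb : b ∈ S := ha
  have hmem : ∀ b ∈ S, b ∈ c.target ∧ c.symm b ∈ (z.baseSet ∩ z'.baseSet) ×ˢ univ ∧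
      (fun a : X × Torus L => (a.1, 𝒜.homeo (div (z' a.1) (z a.1)) a.2)) (c.symm b) =
        e' (e.symm (c.symm b)) ∧
      e' (e.symm (c.symm b)) ∈ c'.source := by
    intro b hb
    simp only [S, OpenPartialHomeomorph.trans_source, OpenPartialHomeomorph.symm_source,
      OpenPartialHomeomorph.trans_target, mem_inter_iff, mem_preimage,
      OpenPartialHomeomorph.coe_trans_symm, Function.comp_apply] at hb
    obtain ⟨⟨h1, h2⟩, h3, h4⟩ := hb
    have h2' : (c.symm b).1 ∈ z.baseSet := h2.1
    have h5 : Assoc.proj B 𝒜.homeo (e.symm (c.symm b)) = (c.symm b).1 :=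
      z.proj_toFun _ h2'
    have h3' : (c.symm b).1 ∈ z'.baseSet := by
      rw [← h5]; exact h3
    refine ⟨h1, ⟨⟨h2', h3'⟩, trivial⟩, ?_, h4⟩
    refine Prod.ext h5.symm ?_
    have h6 := z.proj_toFun _ h2'
    have h7 := Assoc.coord_mk (ρ := 𝒜.homeo) z' (q := z (c.symm b).1) (h6.symm ▸ h3') (c.symm b).2
    rw [h6] at h7
    exact h7.symm
  have hopen : IsOpen S := OpenPartialHomeomorph.open_source _
  have hS : ContMDiffOn J J ∞ (fun b => c' (e' (e.symm (c.symm b)))) S := by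
    have h1 := ht.comp (hc1.mono fun b hb => (hmem b hb).1) fun b hb => (hmem b hb).2.1
    refine (hc2.comp h1 fun b hb => ?_).congr fun b hb => ?_
    · have h2 := (hmem b hb).2.2.2
      rw [← (hmem b hb).2.2.1] at h2
      exact h2
    · exact congrArg c' (hmem b hb).2.2.1.symm
  exact (hI.comp_contMDiffOn (hS.comp (hIs.mono inter_subset_right) fun a ha => ha.1)) a ⟨ha, har⟩

end TorusBundle

/-! ### The vector bundle `Q ×_P ℝ^d` -/

section VectorBundle

variable {P : Type*} [Group P] [TopologicalSpace P] [DiscreteTopology P] {X : Type*}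
  [TopologicalSpace X] (B : PrincipalBundle P X) {d : ℕ} {L : Submodule ℤ (Euc d)}
  [DiscreteTopology L] (𝒜 : AffineTorusAction P L)

/-- The fibre at `x` of the associated vector bundle `Q ×_P ℝ^d`, where `P` acts on `ℝ^d` through
the linear parts `A_p`. -/
def VecFiber (x : X) : Type _ := {e : B.Assoc 𝒜.linHomeo // Assoc.proj B 𝒜.linHomeo e = x}

instance (x : X) : TopologicalSpace (B.VecFiber 𝒜 x) :=
  inferInstanceAs (TopologicalSpace {e : B.Assoc 𝒜.linHomeo // Assoc.proj B 𝒜.linHomeo e = x})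

/-- The class `[q, ξ]` in the fibre of `Q ×_P ℝ^d` at `x`, for a point `q` of `Q` over `x`. -/
def vecMk {x : X} (q : B.Total) (hq : B.proj q = x) (ξ : Euc d) : B.VecFiber 𝒜 x :=
  ⟨Assoc.mk B 𝒜.linHomeo q ξ, hq⟩

variable {B 𝒜}

theorem vecMk_bijective {x : X} (q : B.Total) (hq : B.proj q = x) :
    Function.Bijective (vecMk B 𝒜 q hq) := by
  constructor
  · intro ξ η h
    exact Assoc.mk_injective q (congrArg Subtype.val h)
  · rintro ⟨e, he⟩
    obtain ⟨q', f, rfl⟩ := Assoc.exists_mk_eq e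
    refine ⟨𝒜.linHomeo (div q q') f, Subtype.ext ?_⟩
    exact (Assoc.mk_eq_mk_div (ρ := 𝒜.linHomeo) (hq.trans he.symm) f).symm

/-- The frame `ξ ↦ [q, ξ]` of the fibre at `x` defined by `q`. -/
def vecEquiv {x : X} (q : B.Total) (hq : B.proj q = x) : Euc d ≃ B.VecFiber 𝒜 x :=
  Equiv.ofBijective _ (vecMk_bijective q hq)

instance (x : X) : AddCommGroup (B.VecFiber 𝒜 x) :=
  (vecEquiv (exists_proj_eq (B := B) x).choose
    (exists_proj_eq (B := B) x).choose_spec).symm.addCommGroup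

/-- The vector space structure on the fibres, see `vecMk_add` and `vecMk_smul`. -/
instance (x : X) : Module ℝ (B.VecFiber 𝒜 x) :=
  (vecEquiv (exists_proj_eq (B := B) x).choose
    (exists_proj_eq (B := B) x).choose_spec).symm.module ℝ

theorem vecMk_eq {x : X} {q q' : B.Total} (hq : B.proj q = x) (hq' : B.proj q' = x) (ξ : Euc d) :
    vecMk B 𝒜 q' hq' ξ = vecMk B 𝒜 q hq (𝒜.lin (div q q') ξ) :=
  Subtype.ext (Assoc.mk_eq_mk_div (ρ := 𝒜.linHomeo) (hq.trans hq'.symm) ξ)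

/-- `[q, ξ + η] = [q, ξ] + [q, η]`. -/
theorem vecMk_add {x : X} (q : B.Total) (hq : B.proj q = x) (ξ η : Euc d) :
    vecMk B 𝒜 q hq (ξ + η) = vecMk B 𝒜 q hq ξ + vecMk B 𝒜 q hq η := by
  set q₀ := (exists_proj_eq (B := B) x).choose
  have hq₀ : B.proj q₀ = x := (exists_proj_eq (B := B) x).choose_spec
  have h : ∀ a b : Euc d, vecMk B 𝒜 q₀ hq₀ a + vecMk B 𝒜 q₀ hq₀ b = vecMk B 𝒜 q₀ hq₀ (a + b) := by
    intro a b
    have := Equiv.add_def (vecEquiv (𝒜 := 𝒜) q₀ hq₀).symm (vecMk B 𝒜 q₀ hq₀ a)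
      (vecMk B 𝒜 q₀ hq₀ b)
    refine this.trans ?_
    have e1 : ∀ a, (vecEquiv (𝒜 := 𝒜) q₀ hq₀).symm (vecMk B 𝒜 q₀ hq₀ a) = a :=
      fun a => (vecEquiv (𝒜 := 𝒜) q₀ hq₀).symm_apply_apply a
    rw [e1, e1]
    rfl
  rw [vecMk_eq hq₀ hq, vecMk_eq hq₀ hq ξ, vecMk_eq hq₀ hq η, h, map_add]

/-- `[q, c ξ] = c [q, ξ]`. -/
theorem vecMk_smul {x : X} (q : B.Total) (hq : B.proj q = x) (c : ℝ) (ξ : Euc d) :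
    vecMk B 𝒜 q hq (c • ξ) = c • vecMk B 𝒜 q hq ξ := by
  set q₀ := (exists_proj_eq (B := B) x).choose
  have hq₀ : B.proj q₀ = x := (exists_proj_eq (B := B) x).choose_spec
  have h : ∀ a : Euc d, c • vecMk B 𝒜 q₀ hq₀ a = vecMk B 𝒜 q₀ hq₀ (c • a) := by
    intro a
    have := Equiv.smul_def (vecEquiv (𝒜 := 𝒜) q₀ hq₀).symm c (vecMk B 𝒜 q₀ hq₀ a)
    refine this.trans ?_
    have e1 : ∀ a, (vecEquiv (𝒜 := 𝒜) q₀ hq₀).symm (vecMk B 𝒜 q₀ hq₀ a) = a :=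
      fun a => (vecEquiv (𝒜 := 𝒜) q₀ hq₀).symm_apply_apply a
    rw [e1]
    rfl
  rw [vecMk_eq hq₀ hq, vecMk_eq hq₀ hq ξ, h, map_smul]

variable (B 𝒜) in
/-- The identification of the total space `⨆ₓ (Q ×_P ℝ^d)_x` with `Q ×_P ℝ^d`. -/
def vecTotalEquiv : TotalSpace (Euc d) (B.VecFiber 𝒜) ≃ B.Assoc 𝒜.linHomeo where
  toFun e := e.2.1
  invFun e := ⟨Assoc.proj B 𝒜.linHomeo e, ⟨e, rfl⟩⟩
  left_inv := by rintro ⟨_, ⟨e, rfl⟩⟩; rfl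
  right_inv _ := rfl

instance : TopologicalSpace (TotalSpace (Euc d) (B.VecFiber 𝒜)) :=
  TopologicalSpace.induced (vecTotalEquiv B 𝒜) inferInstance

variable (B 𝒜) in
/-- The total space of the family of fibres is homeomorphic to `Q ×_P ℝ^d`. -/
def vecTotalHomeo : TotalSpace (Euc d) (B.VecFiber 𝒜) ≃ₜ B.Assoc 𝒜.linHomeo :=
  (vecTotalEquiv B 𝒜).toHomeomorphOfIsInducing ⟨rfl⟩

theorem proj_vecTotalHomeo (e : TotalSpace (Euc d) (B.VecFiber 𝒜)) :
    Assoc.proj B 𝒜.linHomeo (vecTotalHomeo B 𝒜 e) = e.proj := e.2.2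

/-- The trivialization `[z(x), ξ] ↦ (x, ξ)` of `Q ×_P ℝ^d` defined by a local section of `Q`. -/
def vecTriv (z : B.LocalSection) : Trivialization (Euc d) (π (Euc d) (B.VecFiber 𝒜)) where
  toOpenPartialHomeomorph := (vecTotalHomeo B 𝒜).toOpenPartialHomeomorph.trans
    (Assoc.localTriv (ρ := 𝒜.linHomeo) z).toOpenPartialHomeomorph
  baseSet := z.baseSet
  open_baseSet := z.isOpen_baseSet
  source_eq := by
    ext e
    simp only [OpenPartialHomeomorph.trans_source, Homeomorph.toOpenPartialHomeomorph_source,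
      univ_inter, mem_preimage, Trivialization.mem_source]
    change Assoc.proj B 𝒜.linHomeo (vecTotalHomeo B 𝒜 e) ∈ z.baseSet ↔ e.proj ∈ z.baseSet
    rw [proj_vecTotalHomeo]
  target_eq := by
    simp only [OpenPartialHomeomorph.trans_target, Homeomorph.toOpenPartialHomeomorph_target,
      preimage_univ, inter_univ]
    rfl
  proj_toFun e _ := proj_vecTotalHomeo e

theorem vecTriv_apply (z : B.LocalSection) {x : X} (hx : x ∈ z.baseSet) (ξ : Euc d) :
    vecTriv (𝒜 := 𝒜) z ⟨x, vecMk B 𝒜 (z x) (z.proj_toFun x hx) ξ⟩ = (x, ξ) := by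
  refine Prod.ext (z.proj_toFun x hx) ?_
  exact Assoc.coord_mk_section (ρ := 𝒜.linHomeo) z hx ξ

instance : FiberBundle (Euc d) (B.VecFiber 𝒜) where
  totalSpaceMk_isInducing' x := by
    refine IsInducing.of_comp_iff (g := vecTotalHomeo B 𝒜) (vecTotalHomeo B 𝒜).isInducing |>.1 ?_
    exact IsInducing.subtypeVal
  trivializationAtlas' := range vecTriv
  trivializationAt' x := vecTriv (B.sectionAt x)
  mem_baseSet_trivializationAt' x := mem_sectionAt x
  trivialization_mem_atlas' x := mem_range_self _

theorem vecMk_surj (z : B.LocalSection) {x : X} (hx : x ∈ z.baseSet) (e : B.VecFiber 𝒜 x) :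
    ∃ ξ, vecMk B 𝒜 (z x) (z.proj_toFun x hx) ξ = e :=
  (vecMk_bijective (z x) (z.proj_toFun x hx)).2 e

instance vecTriv_isLinear (z : B.LocalSection) : (vecTriv (𝒜 := 𝒜) z).IsLinear ℝ where
  linear x hx := by
    constructor
    · intro e e'
      obtain ⟨ξ, rfl⟩ := vecMk_surj z hx e
      obtain ⟨η, rfl⟩ := vecMk_surj z hx e'
      rw [← vecMk_add, vecTriv_apply z hx, vecTriv_apply z hx, vecTriv_apply z hx]
    · intro c e
      obtain ⟨ξ, rfl⟩ := vecMk_surj z hx e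
      rw [← vecMk_smul, vecTriv_apply z hx, vecTriv_apply z hx]

theorem vecTriv_coordChangeL (z z' : B.LocalSection) {x : X}
    (hx : x ∈ z.baseSet ∩ z'.baseSet) :
    ((vecTriv (𝒜 := 𝒜) z).coordChangeL ℝ (vecTriv z') x : Euc d →L[ℝ] Euc d) =
      ((𝒜.lin (div (z' x) (z x))).toContinuousLinearEquiv : Euc d →L[ℝ] Euc d) := by
  ext1 ξ
  have h1 : (⟨x, vecMk B 𝒜 (z x) (z.proj_toFun x hx.1) ξ⟩ : TotalSpace (Euc d) (B.VecFiber 𝒜)) =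
      (vecTriv (𝒜 := 𝒜) z).toOpenPartialHomeomorph.symm (x, ξ) := by
    rw [← vecTriv_apply (𝒜 := 𝒜) z hx.1 ξ]
    refine ((vecTriv (𝒜 := 𝒜) z).left_inv ?_).symm
    rw [Trivialization.mem_source]
    exact hx.1
  have h2 := (vecTriv (𝒜 := 𝒜) z).coordChangeL_apply' (R := ℝ) (vecTriv (𝒜 := 𝒜) z') (b := x) hx ξ
  refine h2.trans ?_
  rw [← h1, vecMk_eq (z'.proj_toFun x hx.2) (z.proj_toFun x hx.1), vecTriv_apply z' hx.2]
  rfl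

theorem eventually_div_eq (z z' : B.LocalSection) {x : X} (hx : x ∈ z.baseSet ∩ z'.baseSet) :
    ∀ᶠ y in 𝓝[z.baseSet ∩ z'.baseSet] x, div (z' y) (z y) = div (z' x) (z x) := by
  have hd : ContinuousOn (fun x => div (z' x) (z x)) (z.baseSet ∩ z'.baseSet) :=
    continuousOn_div (z'.continuousOn_toFun.mono inter_subset_right)
      (z.continuousOn_toFun.mono inter_subset_left)
      fun x hx => by rw [z.proj_toFun x hx.1, z'.proj_toFun x hx.2]
  exact (hd x hx).eventually_mem ((isOpen_discrete {div (z' x) (z x)}).mem_nhds rfl)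

theorem vecTriv_coordChangeL_eventuallyEq (z z' : B.LocalSection) {x : X}
    (hx : x ∈ z.baseSet ∩ z'.baseSet) :
    (fun y => ((vecTriv (𝒜 := 𝒜) z).coordChangeL ℝ (vecTriv z') y : Euc d →L[ℝ] Euc d))
      =ᶠ[𝓝[z.baseSet ∩ z'.baseSet] x] fun _ =>
      ((𝒜.lin (div (z' x) (z x))).toContinuousLinearEquiv : Euc d →L[ℝ] Euc d) := by
  filter_upwards [eventually_div_eq z z' hx, self_mem_nhdsWithin] with y hy hys
  rw [vecTriv_coordChangeL z z' hys, hy]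

instance : VectorBundle ℝ (Euc d) (B.VecFiber 𝒜) where
  trivialization_linear' := by
    rintro _ ⟨z, rfl⟩
    infer_instance
  continuousOn_coordChange' := by
    rintro _ _ ⟨z, rfl⟩ ⟨z', rfl⟩ x hx
    have h := vecTriv_coordChangeL_eventuallyEq (𝒜 := 𝒜) z z' hx
    exact continuousWithinAt_const.congr_of_eventuallyEq h (h.self_of_nhdsWithin hx)

/-- A linear homeomorphism of the fibre with `ℝ^d`. -/
theorem exists_continuousLinearEquiv (x : X) : Nonempty (B.VecFiber 𝒜 x ≃L[ℝ] Euc d) :=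
  ⟨(vecTriv (B.sectionAt x)).continuousLinearEquivAt ℝ x (mem_sectionAt x)⟩

instance (x : X) : IsTopologicalAddGroup (B.VecFiber 𝒜 x) := by
  obtain ⟨e⟩ := exists_continuousLinearEquiv (𝒜 := 𝒜) x
  exact e.toHomeomorph.isInducing.topologicalAddGroup e.toLinearEquiv.toAddMonoidHom

instance (x : X) : ContinuousSMul ℝ (B.VecFiber 𝒜 x) := by
  obtain ⟨e⟩ := exists_continuousLinearEquiv (𝒜 := 𝒜) x
  exact e.toHomeomorph.isInducing.continuousSMul continuous_id (e.map_smul _ _)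

instance {E : Type*} [NormedAddCommGroup E] [NormedSpace ℝ E] [ChartedSpace E X] :
    ContMDiffVectorBundle ∞ (Euc d) (B.VecFiber 𝒜) 𝓘(ℝ, E) where
  contMDiffOn_coordChangeL := by
    rintro _ _ ⟨z, rfl⟩ ⟨z', rfl⟩ x hx
    have h := vecTriv_coordChangeL_eventuallyEq (𝒜 := 𝒜) z z' hx
    exact contMDiffWithinAt_const.congr_of_eventuallyEq h (h.self_of_nhdsWithin hx)

end VectorBundle

/-- A point of the fibre at `x` regarded as a point of the fibre at `x' = x`. -/
def VecFiber.cast {P : Type*} [Group P] [TopologicalSpace P] [DiscreteTopology P] {X : Type*}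
    [TopologicalSpace X] {B : PrincipalBundle P X} {d : ℕ} {L : Submodule ℤ (Euc d)}
    [DiscreteTopology L] {𝒜 : AffineTorusAction P L} {x x' : X} (h : x = x')
    (e : B.VecFiber 𝒜 x) : B.VecFiber 𝒜 x' := ⟨e.1, e.2.trans h⟩

end PrincipalBundle

/-! ## Ehresmann connections and covariant differentials -/

section Connection

variable {F : Type*} [NormedAddCommGroup F] [NormedSpace ℝ F] {HY : Type*} [TopologicalSpace HY]
  (J : ModelWithCorners ℝ F HY) {Y : Type*} [TopologicalSpace Y] [ChartedSpace HY Y]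
  [IsManifold J ∞ Y]
  {E : Type*} [NormedAddCommGroup E] [NormedSpace ℝ E] {HX : Type*} [TopologicalSpace HX]
  (I : ModelWithCorners ℝ E HX) {X : Type*} [TopologicalSpace X] [ChartedSpace HX X]

/-- The vertical tangent space `V_y Y = ker (T_y f)` of a map `f : Y → X`. -/
def verticalSpace (f : Y → X) (y : Y) : Submodule ℝ (TangentSpace J y) :=
  LinearMap.ker (mfderiv J I f y : TangentSpace J y →ₗ[ℝ] TangentSpace I (f y))

/-- A smooth Ehresmann connection on `f : Y → X`: a smooth field of projections of the tangent
spaces of `Y` onto the vertical tangent spaces. Equivalently, a smooth horizontal distribution,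
namely the kernel of the projections, complementary to the vertical one. -/
@[ext]
structure EhresmannConnection (f : Y → X) where
  /-- the projection onto the vertical space along the horizontal space -/
  vproj : ∀ y : Y, TangentSpace J y →L[ℝ] TangentSpace J y
  vproj_vproj : ∀ y ξ, vproj y (vproj y ξ) = vproj y ξ
  range_vproj : ∀ y, LinearMap.range (vproj y : TangentSpace J y →ₗ[ℝ] TangentSpace J y) =
    verticalSpace J I f y
  contMDiff_vproj : ContMDiff J (J.prod 𝓘(ℝ, F →L[ℝ] F)) ∞ fun y =>
    TotalSpace.mk' (F →L[ℝ] F) (E := fun y => TangentSpace J y →L[ℝ] TangentSpace J y) y (vproj y)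

namespace EhresmannConnection

variable {J I} {f : Y → X}

/-- The horizontal space `H_y Y`. -/
def horizontal (C : EhresmannConnection J I f) (y : Y) : Submodule ℝ (TangentSpace J y) :=
  LinearMap.ker (C.vproj y : TangentSpace J y →ₗ[ℝ] TangentSpace J y)

/-- A connection is flat if its horizontal distribution is integrable: the Lie bracket of
horizontal vector fields is horizontal. -/
def IsFlat (C : EhresmannConnection J I f) : Prop :=
  ∀ (O : Set Y), IsOpen O → ∀ V W : (y : Y) → TangentSpace J y,
    ContMDiffOn J J.tangent ∞ (fun y => (⟨y, V y⟩ : TangentBundle J Y)) O →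
    ContMDiffOn J J.tangent ∞ (fun y => (⟨y, W y⟩ : TangentBundle J Y)) O →
    (∀ y ∈ O, V y ∈ C.horizontal y) → (∀ y ∈ O, W y ∈ C.horizontal y) →
    ∀ y ∈ O, VectorField.mlieBracket J V W y ∈ C.horizontal y

/-- The covariant differential `∇σ` of a section `σ` at `x`: the vertical part of the first jet
`T_x σ : T_x X → T_{σ(x)} Y`, that is, the difference between `T_x σ` and the horizontal lift. -/
def covariantDifferential (C : EhresmannConnection J I f) (σ : X → Y) (x : X) :
    TangentSpace I x →L[ℝ] TangentSpace J (σ x) :=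
  (C.vproj (σ x)).comp (mfderiv I J σ x)

end EhresmannConnection

end Connection

namespace PrincipalBundle

section Main

variable {P : Type*} [Group P] [TopologicalSpace P] [DiscreteTopology P]
  {d : ℕ} {L : Submodule ℤ (Euc d)} [DiscreteTopology L]
  {E : Type*} [NormedAddCommGroup E] [NormedSpace ℝ E]
  {X : Type*} [TopologicalSpace X] [ChartedSpace E X] [IsManifold 𝓘(ℝ, E) ∞ X]
  (B : PrincipalBundle P X) (𝒜 : AffineTorusAction P L)

/-- The projection of the torus bundle. -/
abbrev torusProj : B.TorusBundle 𝒜 → X := Assoc.proj B 𝒜.homeo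

/-- The admissible local trivialization of the torus bundle defined by a local section of `Q`. -/
abbrev torusTriv {B : PrincipalBundle P X} (𝒜 : AffineTorusAction P L) (z : B.LocalSection) :
    Trivialization (Torus L) (B.torusProj 𝒜) := Assoc.localTriv z

variable {B 𝒜}

/-- A connection on the torus bundle is the canonical one if, in every admissible local
trivialization `Y|_U ≃ U × ℝ^d / L`, its horizontal distribution is `TU ⊕ 0`. -/
def IsCanonical (C : EhresmannConnection (𝓘(ℝ, E).prod 𝓘(ℝ, Euc d)) 𝓘(ℝ, E) (B.torusProj 𝒜)) :
    Prop :=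
  ∀ (z : B.LocalSection) (y : B.TorusBundle 𝒜), B.torusProj 𝒜 y ∈ z.baseSet →
    ∀ ξ : TangentSpace (𝓘(ℝ, E).prod 𝓘(ℝ, Euc d)) y, ξ ∈ C.horizontal y ↔
      (mfderiv (𝓘(ℝ, E).prod 𝓘(ℝ, Euc d)) (𝓘(ℝ, E).prod 𝓘(ℝ, Euc d)) (torusTriv 𝒜 z) y ξ).2 = 0

/-- `u : W → ℝ^d` is a (continuous) local lift over the open set `W ⊆ U` of the torus-valued
representative of the section `σ` in the admissible trivialization over `U` defined by `z`. -/
structure IsLocalLift (z : B.LocalSection) (σ : X → B.TorusBundle 𝒜) (W : Set X)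
    (u : X → Euc d) : Prop where
  isOpen : IsOpen W
  subset : W ⊆ z.baseSet
  continuousOn : ContinuousOn u W
  mk_eq : ∀ x ∈ W, Torus.mk L (u x) = (torusTriv 𝒜 z (σ x)).2

end Main

end PrincipalBundle

end CrystalBundle

end

/-!
Everything is local over the base and reduces to the product `X × ℝ^d / L`, because two admissible
trivializations differ by `(x, τ) ↦ (x, g(x) τ)` with `g` locally constant in `P`.

The torus is canonically parallelized: its charts are local inverses of `Torus.mk`, so they differ
by translations, every tangent space of the torus is `ℝ^d`, and the derivatives of `Torus.mk` and of
the charts are the identity (`Torus.hasMFDerivAt_mk`, `Torus.hasMFDerivAt_of_mem_atlas`), while an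
affine map of the torus has its linear part as derivative (`Torus.hasMFDerivAt_homeo`). Hence a local
section `z` of `Q` gives at each `y` over its domain a vertical coordinate
`vertCoord z y : T_y Y → ℝ^d`. Together with the derivative of the projection it is injective
(`eq_of_vertCoord_eq`), and a change of frame multiplies it by `A_g`
(`vertCoord_eq_lin_vertCoord`). The consequences are as follows.

* The kernel of `vertCoord z y` does not depend on `z`. It is the horizontal space of the canonical
  connection. In the charts of `Y` the vertical coordinate is the second component
  (`snd_mfderiv_extChartAt`), so the vertical projection is the constant map `(a, b) ↦ (0, b)`, and
  the horizontal fields are those with vanishing second component. This gives smoothness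
  (`contMDiff_canonicalVproj`) and flatness (`IsCanonical.isFlat`). Uniqueness holds because a
  projection is determined by its kernel and its range (`IsCanonical.vproj_eq`).
* The coordinates of `Q ×_P ℝ^d` transform by the same `A_g`, so equality of coordinates identifies
  its fibres with the vertical spaces (`vertEquiv`, `vertCoord_vertEquiv`).
* The vertical coordinate of the derivative of a section is the derivative of its torus-valued
  representative, which is the derivative of any lift to `ℝ^d` (`IsLocalLift.vecTriv_covDiff`). Two
  lifts of one torus-valued map differ by a locally constant vector of the discrete group `L`
  (`Torus.eventually_eq_add_of_mk_eq`), which makes lifts smooth and yields the transition law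
  (`IsLocalLift.exists_transition`).
-/

noncomputable section

namespace CrystalBundle

/-! ### Calculus on the translation torus -/

namespace Torus

section Calculus

variable {d : ℕ} {L : Submodule ℤ (Euc d)} [DiscreteTopology L]

/-- Two continuous lifts of the same torus-valued map differ by a locally constant lattice
vector. -/
theorem eventually_eq_add_of_mk_eq {T : Type*} [TopologicalSpace T] {f g : T → Euc d} {t : T}
    (hf : ContinuousAt f t) (hg : ContinuousAt g t)
    (h : ∀ᶠ s in 𝓝 t, mk L (f s) = mk L (g s)) :
    ∃ l ∈ L, ∀ᶠ s in 𝓝 t, f s = g s + l := by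
  have h0 := (mk_eq_mk L).1 h.self_of_nhds
  refine ⟨f t - g t, by simpa using L.neg_mem h0, ?_⟩
  -- `U` isolates `0` in `L`, and the lattice vector `(f s - g s) - (f t - g t)` lies in `U` near `t`.
  obtain ⟨U, hU, hUL⟩ : ∃ U ∈ 𝓝 (0 : Euc d), ∀ x ∈ U, x ∈ L → x = 0 := by
    have h0 : ({0} : Set L) ∈ 𝓝 (0 : L) := by simp
    rw [nhds_subtype_eq_comap, Filter.mem_comap] at h0
    obtain ⟨U, hU, hs⟩ := h0
    refine ⟨U, hU, fun x hx hxL => ?_⟩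
    have : (⟨x, hxL⟩ : L) ∈ ({0} : Set L) := hs hx
    simpa using congrArg Subtype.val this
  have hc : ContinuousAt (fun s => (f s - g s) - (f t - g t)) t :=
    (hf.sub hg).sub continuousAt_const
  have hmem : ∀ᶠ s in 𝓝 t, (f s - g s) - (f t - g t) ∈ U := by
    apply hc.eventually_mem
    simpa using hU
  filter_upwards [h, hmem] with s hs hsU
  have h3 := L.sub_mem h0 ((mk_eq_mk L).1 hs)
  rw [show g t - f t - (g s - f s) = (f s - g s) - (f t - g t) by abel] at h3
  rw [← sub_eq_zero.1 (hUL _ hsU h3)]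
  abel

theorem chart_mk_eventuallyEq {e : OpenPartialHomeomorph (Torus L) (Euc d)}
    (he : e ∈ atlas (Euc d) (Torus L)) {v : Euc d} (hv : mk L v ∈ e.source) :
    ∃ l ∈ L, ∀ᶠ w in 𝓝 v, e (mk L w) = w + l := by
  have hmk := (continuous_mk L).continuousAt (x := v)
  refine eventually_eq_add_of_mk_eq (L := L) ((e.continuousAt hv).comp hmk) continuousAt_id ?_
  filter_upwards [hmk.eventually_mem (e.open_source.mem_nhds hv)] with w hw
  exact mk_chart he hw

/-- The charts of the torus are local inverses of `mk`, so that the tangent spaces of the torus are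
`ℝ^d` in a canonical way, and the derivative of `mk` is the identity. -/
theorem hasMFDerivAt_mk (v : Euc d) :
    HasMFDerivAt 𝓘(ℝ, Euc d) 𝓘(ℝ, Euc d) (mk L) v (ContinuousLinearMap.id ℝ (Euc d)) := by
  refine ⟨(continuous_mk L).continuousAt, ?_⟩
  obtain ⟨l, -, h⟩ := chart_mk_eventuallyEq (chart_mem_atlas (Euc d) (mk L v))
    (mem_chart_source _ _)
  have h2 : HasFDerivAt (fun w : Euc d => w + l) (ContinuousLinearMap.id ℝ (Euc d)) v :=
    (hasFDerivAt_id v).add_const l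
  exact (h2.congr_of_eventuallyEq h).hasFDerivWithinAt

theorem hasMFDerivAt_of_mem_atlas {e : OpenPartialHomeomorph (Torus L) (Euc d)}
    (he : e ∈ atlas (Euc d) (Torus L)) {t : Torus L} (ht : t ∈ e.source) :
    HasMFDerivAt 𝓘(ℝ, Euc d) 𝓘(ℝ, Euc d) e t (ContinuousLinearMap.id ℝ (Euc d)) := by
  refine ⟨e.continuousAt ht, ?_⟩
  set c := chartAt (Euc d) t
  have hc : c ∈ atlas (Euc d) (Torus L) := chart_mem_atlas _ _
  have hct : mk L (c t) = t := mk_chart hc (mem_chart_source _ _)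
  obtain ⟨l, -, h⟩ := chart_mk_eventuallyEq he (v := c t) (hct.symm ▸ ht)
  have h2 : HasFDerivAt (fun w : Euc d => w + l) (ContinuousLinearMap.id ℝ (Euc d)) (c t) :=
    (hasFDerivAt_id _).add_const l
  have h3 : HasFDerivAt (fun w : Euc d => e (c.symm w)) (ContinuousLinearMap.id ℝ (Euc d)) (c t) :=
    h2.congr_of_eventuallyEq (h.mono fun w hw => (congrArg e (chart_symm hc w)).trans hw)
  exact h3.hasFDerivWithinAt

theorem contMDiffAt_of_mem_atlas {e : OpenPartialHomeomorph (Torus L) (Euc d)}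
    (he : e ∈ atlas (Euc d) (Torus L)) {t : Torus L} (ht : t ∈ e.source) :
    ContMDiffAt 𝓘(ℝ, Euc d) 𝓘(ℝ, Euc d) ∞ e t :=
  contMDiffAt_of_mem_maximalAtlas (IsManifold.subset_maximalAtlas he) ht

/-- Under the identification of the tangent spaces of the torus with `ℝ^d`, the element `p` acts
with derivative `A_p`. -/
theorem hasMFDerivAt_homeo {P : Type*} [Group P] (𝒜 : AffineTorusAction P L) (p : P)
    (t : Torus L) :
    HasMFDerivAt 𝓘(ℝ, Euc d) 𝓘(ℝ, Euc d) (𝒜.homeo p) t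
      ((𝒜.lin p).toContinuousLinearEquiv : Euc d →L[ℝ] Euc d) := by
  have hd := ((𝒜.contMDiff_homeo p).mdifferentiable (by simp) t).hasMFDerivAt
  obtain ⟨v, rfl⟩ := mk_surjective L t
  have h1 := hd.comp v (hasMFDerivAt_mk v)
  have h2 : HasMFDerivAt 𝓘(ℝ, Euc d) 𝓘(ℝ, Euc d) (fun w => 𝒜.lin p w + 𝒜.shift p) v
      ((𝒜.lin p).toContinuousLinearEquiv : Euc d →L[ℝ] Euc d) :=
    (((𝒜.lin p).toContinuousLinearEquiv.hasFDerivAt (x := v)).add_const _).hasMFDerivAt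
  have h3 := (hasMFDerivAt_mk (L := L) (𝒜.lin p v + 𝒜.shift p)).comp v h2
  have h4 : 𝒜.homeo p ∘ mk L = mk L ∘ fun w => 𝒜.lin p w + 𝒜.shift p :=
    funext (𝒜.homeo_mk p)
  rw [h4] at h1
  have h5 := hasMFDerivAt_unique h1 h3
  have h6 : mfderiv 𝓘(ℝ, Euc d) 𝓘(ℝ, Euc d) (𝒜.homeo p) (mk L v) =
      ((𝒜.lin p).toContinuousLinearEquiv : Euc d →L[ℝ] Euc d) := by
    ext1 ξ
    exact DFunLike.congr_fun h5 ξ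
  rw [← h6]
  exact hd

section Lift

variable {E : Type*} [NormedAddCommGroup E] [NormedSpace ℝ E]
  {X : Type*} [TopologicalSpace X] [ChartedSpace E X] {s : X → Torus L} {u : X → Euc d} {x : X}

/-- A continuous lift of a torus-valued map agrees, up to a constant, with the composition of the
map and a chart of the torus. -/
theorem lift_eventuallyEq (hs : ContinuousAt s x) (hu : ContinuousAt u x)
    (h : ∀ᶠ y in 𝓝 x, mk L (u y) = s y) :
    ∃ l, u =ᶠ[𝓝 x] fun y => chartAt (Euc d) (s x) (s y) + l := by
  set e := chartAt (Euc d) (s x)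
  have hx : s x ∈ e.source := mem_chart_source _ _
  obtain ⟨l, -, hl⟩ := eventually_eq_add_of_mk_eq (L := L) hu
    (g := fun y => e (s y)) (ContinuousAt.comp (g := e) (e.continuousAt hx) hs) (by
      filter_upwards [h, hs.eventually_mem (e.open_source.mem_nhds hx)] with y hy hy'
      rw [mk_chart (chart_mem_atlas _ _) hy', hy])
  exact ⟨l, hl⟩

theorem contMDiffAt_lift (hs : ContMDiffAt 𝓘(ℝ, E) 𝓘(ℝ, Euc d) ∞ s x) (hu : ContinuousAt u x)
    (h : ∀ᶠ y in 𝓝 x, mk L (u y) = s y) : ContMDiffAt 𝓘(ℝ, E) 𝓘(ℝ, Euc d) ∞ u x := by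
  obtain ⟨l, hl⟩ := lift_eventuallyEq hs.continuousAt hu h
  refine ContMDiffAt.congr_of_eventuallyEq ?_ hl
  exact ((contMDiffAt_of_mem_atlas (chart_mem_atlas _ _) (mem_chart_source _ _)).comp x hs).add
    contMDiffAt_const

theorem mfderiv_lift (hu : MDifferentiableAt 𝓘(ℝ, E) 𝓘(ℝ, Euc d) u x)
    (h : ∀ᶠ y in 𝓝 x, mk L (u y) = s y) (w : TangentSpace 𝓘(ℝ, E) x) :
    (mfderiv 𝓘(ℝ, E) 𝓘(ℝ, Euc d) u x w : Euc d) = mfderiv 𝓘(ℝ, E) 𝓘(ℝ, Euc d) s x w := by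
  have h1 := (hasMFDerivAt_mk (L := L) (u x)).comp x hu.hasMFDerivAt
  have h2 := (h1.congr_of_eventuallyEq (f₁ := s) (h.mono fun y hy => hy.symm)).mfderiv
  rw [h2]
  rfl

end Lift

end Calculus

end Torus

/-! ### Smoothness of the admissible trivializations -/

namespace AffineTorusAction

variable {P : Type*} [Group P] {d : ℕ} {L : Submodule ℤ (Euc d)} [DiscreteTopology L]

theorem lin_one (𝒜 : AffineTorusAction P L) (η : Euc d) : 𝒜.lin 1 η = η := by
  have h : 𝒜.lin 1 = 1 := map_one 𝒜.linHom
  rw [h]; rfl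

theorem lin_inv (𝒜 : AffineTorusAction P L) (g : P) (v : Euc d) :
    𝒜.lin g⁻¹ v = (𝒜.lin g).symm v := by
  have h : 𝒜.lin g⁻¹ = (𝒜.lin g)⁻¹ := map_inv 𝒜.linHom g
  rw [h]
  rfl

end AffineTorusAction

namespace PrincipalBundle

section Div

variable {P : Type*} [Group P] [TopologicalSpace P] [DiscreteTopology P]
  {X : Type*} [TopologicalSpace X] {B : PrincipalBundle P X}

theorem div_self_eq_one (q : B.Total) : div q q = 1 := div_eq (by simp)

theorem div_symm {q q' : B.Total} (h : B.proj q = B.proj q') : div q' q = (div q q')⁻¹ := by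
  apply div_eq
  have := smul_div h
  rw [← this, smul_smul]
  simp [this]

end Div

section TorusBundleCalculus

variable {P : Type*} [Group P] [TopologicalSpace P] [DiscreteTopology P]
  {d : ℕ} {L : Submodule ℤ (Euc d)} [DiscreteTopology L]
  {E : Type*} [NormedAddCommGroup E] [NormedSpace ℝ E]
  {X : Type*} [TopologicalSpace X] [ChartedSpace E X] [IsManifold 𝓘(ℝ, E) ∞ X]
  {B : PrincipalBundle P X} {𝒜 : AffineTorusAction P L}

/-- The change of frame in an associated bundle with fibre `F`. -/
theorem coord_eq_coord {F : Type*} [TopologicalSpace F] {ρ : P →* (F ≃ₜ F)}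
    (z z' : B.LocalSection) {y : B.Assoc ρ} (hy : Assoc.proj B ρ y ∈ z.baseSet)
    (hy' : Assoc.proj B ρ y ∈ z'.baseSet) :
    Assoc.coord z' y =
      ρ (div (z' (Assoc.proj B ρ y)) (z (Assoc.proj B ρ y))) (Assoc.coord z y) := by
  have hp := z.proj_toFun _ hy
  have h := Assoc.coord_mk (ρ := ρ) z' (q := z (Assoc.proj B ρ y)) (hp.symm ▸ hy')
    (Assoc.coord z y)
  rw [Assoc.mk_coord z hy, hp] at h
  exact h

theorem contMDiffOn_torusTriv (z : B.LocalSection) :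
    ContMDiffOn (𝓘(ℝ, E).prod 𝓘(ℝ, Euc d)) (𝓘(ℝ, E).prod 𝓘(ℝ, Euc d)) ∞
      (torusTriv 𝒜 z) (torusTriv 𝒜 z).source := by
  intro y hy
  apply ContMDiffAt.contMDiffWithinAt
  set z₀ := B.sectionAt (B.torusProj 𝒜 y)
  have hy₀ : B.torusProj 𝒜 y ∈ z₀.baseSet := mem_sectionAt _
  set c := chartAt (ModelProd E (Euc d)) (torusTriv 𝒜 z₀ y)
  have hc : torusTriv 𝒜 z₀ y ∈ c.source := mem_chart_source _ _
  have hchart : ContMDiffAt (𝓘(ℝ, E).prod 𝓘(ℝ, Euc d)) (𝓘(ℝ, E).prod 𝓘(ℝ, Euc d)) ∞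
      (fun y => c (torusTriv 𝒜 z₀ y)) y :=
    contMDiffAt_of_mem_maximalAtlas (IsManifold.chart_mem_maximalAtlas y) (mem_chart_source _ y)
  have h₀ : ContMDiffAt (𝓘(ℝ, E).prod 𝓘(ℝ, Euc d)) (𝓘(ℝ, E).prod 𝓘(ℝ, Euc d)) ∞
      (torusTriv 𝒜 z₀) y := by
    have h1 := ((contMDiffOn_chart_symm (I := 𝓘(ℝ, E).prod 𝓘(ℝ, Euc d)) (n := ∞)
      (x := torusTriv 𝒜 z₀ y)).contMDiffAt
      (c.open_target.mem_nhds (c.map_source hc))).comp y hchart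
    refine h1.congr_of_eventuallyEq ?_
    have h2 : ContinuousAt (torusTriv 𝒜 z₀) y := (torusTriv 𝒜 z₀).continuousAt hy₀
    filter_upwards [h2.eventually_mem (c.open_source.mem_nhds hc)] with y' hy'
    exact (c.left_inv hy').symm
  have ht := (contMDiffOn_transition (E := E) 𝒜 z₀ z).contMDiffAt (x := torusTriv 𝒜 z₀ y)
    (((z₀.isOpen_baseSet.inter z.isOpen_baseSet).prod isOpen_univ).mem_nhds ⟨⟨hy₀, hy⟩, trivial⟩)
  -- Near `y` the trivialization of `z` is the transition map after the one defining the chart at `y`.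
  refine (ht.comp y h₀).congr_of_eventuallyEq ?_
  filter_upwards [(torusTriv 𝒜 z).open_source.mem_nhds hy,
    (torusTriv 𝒜 z₀).open_source.mem_nhds hy₀] with y' hy' hy'₀
  exact Prod.ext rfl (coord_eq_coord z₀ z hy'₀ hy')

theorem contMDiffOn_torusTriv_symm (z : B.LocalSection) :
    ContMDiffOn (𝓘(ℝ, E).prod 𝓘(ℝ, Euc d)) (𝓘(ℝ, E).prod 𝓘(ℝ, Euc d)) ∞
      (torusTriv 𝒜 z).toOpenPartialHomeomorph.symm (torusTriv 𝒜 z).target := by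
  intro a ha
  apply ContMDiffAt.contMDiffWithinAt
  set y := (torusTriv 𝒜 z).toOpenPartialHomeomorph.symm a
  have hya : torusTriv 𝒜 z y = a := (torusTriv 𝒜 z).right_inv ha
  have hy : B.torusProj 𝒜 y ∈ z.baseSet := (torusTriv 𝒜 z).map_target ha
  set z₀ := B.sectionAt (B.torusProj 𝒜 y)
  have hy₀ : B.torusProj 𝒜 y ∈ z₀.baseSet := mem_sectionAt _
  set c := chartAt (ModelProd E (Euc d)) (torusTriv 𝒜 z₀ y)
  have hc : torusTriv 𝒜 z₀ y ∈ c.source := mem_chart_source _ _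
  set S : Set (X × Torus L) := (z.baseSet ∩ z₀.baseSet) ×ˢ univ
  have hS : S ∈ 𝓝 a := ((z.isOpen_baseSet.inter z₀.isOpen_baseSet).prod isOpen_univ).mem_nhds
    (by rw [← hya]; exact ⟨⟨hy, hy₀⟩, trivial⟩)
  have ht := (contMDiffOn_transition (E := E) 𝒜 z z₀).contMDiffAt (x := a) hS
  set f := fun a : X × Torus L => (a.1, 𝒜.homeo (div (z₀ a.1) (z a.1)) a.2)
  have hf : ∀ a ∈ S, f a = torusTriv 𝒜 z₀ ((torusTriv 𝒜 z).toOpenPartialHomeomorph.symm a) ∧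
      (torusTriv 𝒜 z).toOpenPartialHomeomorph.symm a ∈ (torusTriv 𝒜 z₀).source := by
    intro b hb
    have hbt : b ∈ (torusTriv 𝒜 z).target := ⟨hb.1.1, trivial⟩
    have h1 : torusTriv 𝒜 z ((torusTriv 𝒜 z).toOpenPartialHomeomorph.symm b) = b :=
      (torusTriv 𝒜 z).right_inv hbt
    have h2 : Assoc.proj B 𝒜.homeo ((torusTriv 𝒜 z).toOpenPartialHomeomorph.symm b) = b.1 :=
      congrArg Prod.fst h1
    have h3 := coord_eq_coord (ρ := 𝒜.homeo) z z₀
      (y := (torusTriv 𝒜 z).toOpenPartialHomeomorph.symm b) (h2.symm ▸ hb.1.1)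
      (h2.symm ▸ hb.1.2)
    have h4 : Assoc.coord z ((torusTriv 𝒜 z).toOpenPartialHomeomorph.symm b) = b.2 :=
      congrArg Prod.snd h1
    rw [h2, h4] at h3
    refine ⟨Prod.ext h2.symm h3.symm, ?_⟩
    change Assoc.proj B 𝒜.homeo ((torusTriv 𝒜 z).toOpenPartialHomeomorph.symm b) ∈ z₀.baseSet
    rw [h2]; exact hb.1.2
  have hfa : f a = torusTriv 𝒜 z₀ y := (hf a (mem_of_mem_nhds hS)).1
  have hcf : ContMDiffAt (𝓘(ℝ, E).prod 𝓘(ℝ, Euc d)) (𝓘(ℝ, E).prod 𝓘(ℝ, Euc d)) ∞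
      (fun a => c (f a)) a := by
    refine ContMDiffAt.comp a (g := c) ?_ ht
    rw [hfa]
    exact contMDiffAt_of_mem_maximalAtlas (IsManifold.chart_mem_maximalAtlas _) hc
  have hsymm : ContMDiffAt (𝓘(ℝ, E).prod 𝓘(ℝ, Euc d)) (𝓘(ℝ, E).prod 𝓘(ℝ, Euc d)) ∞
      (chartAt (ModelProd E (Euc d)) y).symm (c (f a)) := by
    rw [hfa]
    exact contMDiffOn_chart_symm.contMDiffAt
      ((chartAt (ModelProd E (Euc d)) y).open_target.mem_nhds
        ((chartAt (ModelProd E (Euc d)) y).map_source (mem_chart_source _ y)))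
  refine (hsymm.comp a hcf).congr_of_eventuallyEq ?_
  filter_upwards [hS, ht.continuousAt.eventually_mem (c.open_source.mem_nhds
    (hfa.symm ▸ hc : f a ∈ c.source))] with b hb hbc
  have h1 : (chartAt (ModelProd E (Euc d)) y).symm (c (f b)) =
      (torusTriv 𝒜 z₀).toOpenPartialHomeomorph.symm (c.symm (c (f b))) := rfl
  have h2 := (torusTriv 𝒜 z₀).left_inv (hf b hb).2
  rw [Function.comp_apply, h1, c.left_inv hbc, (hf b hb).1]
  exact h2.symm

theorem contMDiffAt_torusTriv (z : B.LocalSection) {y : B.TorusBundle 𝒜}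
    (hy : B.torusProj 𝒜 y ∈ z.baseSet) :
    ContMDiffAt (𝓘(ℝ, E).prod 𝓘(ℝ, Euc d)) (𝓘(ℝ, E).prod 𝓘(ℝ, Euc d)) ∞ (torusTriv 𝒜 z) y :=
  (contMDiffOn_torusTriv z).contMDiffAt ((torusTriv 𝒜 z).open_source.mem_nhds hy)

theorem contMDiff_torusProj :
    ContMDiff (𝓘(ℝ, E).prod 𝓘(ℝ, Euc d)) 𝓘(ℝ, E) ∞ (B.torusProj 𝒜) := fun _ =>
  contMDiffAt_fst.comp _ (contMDiffAt_torusTriv _ (mem_sectionAt _))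

theorem contMDiffAt_coord (z : B.LocalSection) {y : B.TorusBundle 𝒜}
    (hy : B.torusProj 𝒜 y ∈ z.baseSet) :
    ContMDiffAt (𝓘(ℝ, E).prod 𝓘(ℝ, Euc d)) 𝓘(ℝ, Euc d) ∞
      (Assoc.coord (ρ := 𝒜.homeo) z) y :=
  contMDiffAt_snd.comp _ (contMDiffAt_torusTriv z hy)

/-- The inclusion `τ ↦ [q, τ]` of a fibre is smooth. -/
theorem contMDiff_assocMk (q : B.Total) :
    ContMDiff 𝓘(ℝ, Euc d) (𝓘(ℝ, E).prod 𝓘(ℝ, Euc d)) ∞ (Assoc.mk B 𝒜.homeo q) := by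
  intro τ
  set z := B.sectionAt (B.proj q)
  have hz : B.proj q ∈ z.baseSet := mem_sectionAt _
  have h1 : Assoc.mk B 𝒜.homeo q = fun τ => (torusTriv 𝒜 z).toOpenPartialHomeomorph.symm
      (B.proj q, 𝒜.homeo (div (z (B.proj q)) q) τ) :=
    funext fun τ => Assoc.mk_eq_mk_div (z.proj_toFun _ hz) τ
  rw [h1]
  have h2 := (contMDiffOn_torusTriv_symm (E := E) (𝒜 := 𝒜) z).contMDiffAt
    (x := (B.proj q, 𝒜.homeo (div (z (B.proj q)) q) τ))
    ((torusTriv 𝒜 z).open_target.mem_nhds ⟨hz, trivial⟩)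
  exact h2.comp τ (contMDiffAt_const.prodMk (𝒜.contMDiff_homeo _ τ))

end TorusBundleCalculus

end PrincipalBundle

/-! ### The vertical coordinate on the torus bundle -/

namespace PrincipalBundle

section VerticalCoordinate

variable {P : Type*} [Group P] [TopologicalSpace P] [DiscreteTopology P]
  {d : ℕ} {L : Submodule ℤ (Euc d)} [DiscreteTopology L]
  {E : Type*} [NormedAddCommGroup E] [NormedSpace ℝ E]
  {X : Type*} [TopologicalSpace X] [ChartedSpace E X] [IsManifold 𝓘(ℝ, E) ∞ X]
  {B : PrincipalBundle P X} {𝒜 : AffineTorusAction P L}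

/-- The derivative at `y` of the torus-valued coordinate defined by a local section of `Q`. Its
values are vectors of `ℝ^d`, the common tangent space of the torus at all of its points. -/
def vertCoord (z : B.LocalSection) (y : B.TorusBundle 𝒜) :
    TangentSpace (𝓘(ℝ, E).prod 𝓘(ℝ, Euc d)) y →L[ℝ] Euc d :=
  mfderiv (𝓘(ℝ, E).prod 𝓘(ℝ, Euc d)) 𝓘(ℝ, Euc d) (Assoc.coord (ρ := 𝒜.homeo) z) y

theorem hasMFDerivAt_coord (z : B.LocalSection) {y : B.TorusBundle 𝒜}
    (hy : B.torusProj 𝒜 y ∈ z.baseSet) :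
    HasMFDerivAt (𝓘(ℝ, E).prod 𝓘(ℝ, Euc d)) 𝓘(ℝ, Euc d) (Assoc.coord (ρ := 𝒜.homeo) z) y
      (vertCoord (E := E) z y) :=
  ((contMDiffAt_coord z hy).mdifferentiableAt (by simp)).hasMFDerivAt

theorem hasMFDerivAt_torusProj (y : B.TorusBundle 𝒜) :
    HasMFDerivAt (𝓘(ℝ, E).prod 𝓘(ℝ, Euc d)) 𝓘(ℝ, E) (B.torusProj 𝒜) y
      (mfderiv (𝓘(ℝ, E).prod 𝓘(ℝ, Euc d)) 𝓘(ℝ, E) (B.torusProj 𝒜) y) :=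
  (contMDiff_torusProj.mdifferentiable (by simp) y).hasMFDerivAt

theorem mfderiv_torusTriv (z : B.LocalSection) {y : B.TorusBundle 𝒜}
    (hy : B.torusProj 𝒜 y ∈ z.baseSet) :
    mfderiv (𝓘(ℝ, E).prod 𝓘(ℝ, Euc d)) (𝓘(ℝ, E).prod 𝓘(ℝ, Euc d)) (torusTriv 𝒜 z) y =
      (mfderiv (𝓘(ℝ, E).prod 𝓘(ℝ, Euc d)) 𝓘(ℝ, E) (B.torusProj 𝒜) y).prod
        (vertCoord (E := E) z y) :=
  ((hasMFDerivAt_torusProj y).prodMk (hasMFDerivAt_coord z hy)).mfderiv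

theorem vertCoord_eq_lin_vertCoord (z z' : B.LocalSection) {y : B.TorusBundle 𝒜}
    (hy : B.torusProj 𝒜 y ∈ z.baseSet) (hy' : B.torusProj 𝒜 y ∈ z'.baseSet)
    (ξ : TangentSpace (𝓘(ℝ, E).prod 𝓘(ℝ, Euc d)) y) :
    vertCoord z' y ξ =
      𝒜.lin (div (z' (B.torusProj 𝒜 y)) (z (B.torusProj 𝒜 y))) (vertCoord z y ξ) := by
  set p := div (z' (B.torusProj 𝒜 y)) (z (B.torusProj 𝒜 y))
  have h1 := (Torus.hasMFDerivAt_homeo 𝒜 p (Assoc.coord z y)).comp y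
    (hasMFDerivAt_coord (E := E) z hy)
  have hp : ∀ᶠ x in 𝓝 (B.torusProj 𝒜 y), div (z' x) (z x) = p := by
    have := eventually_div_eq z z' ⟨hy, hy'⟩
    rwa [(z.isOpen_baseSet.inter z'.isOpen_baseSet).nhdsWithin_eq ⟨hy, hy'⟩] at this
  have h2 : Assoc.coord (ρ := 𝒜.homeo) z' =ᶠ[𝓝 y] 𝒜.homeo p ∘ Assoc.coord z := by
    have hc : ContinuousAt (B.torusProj 𝒜) y := Assoc.continuous_proj.continuousAt
    filter_upwards [hc.eventually hp, hc.eventually (z.isOpen_baseSet.mem_nhds hy),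
      hc.eventually (z'.isOpen_baseSet.mem_nhds hy')] with y' h1 h2 h3
    rw [coord_eq_coord z z' h2 h3, h1]
    rfl
  have h3 := hasMFDerivAt_unique (hasMFDerivAt_coord (E := E) z' hy') (h1.congr_of_eventuallyEq h2)
  exact DFunLike.congr_fun h3 ξ

/-- A tangent vector is determined by its projection to the base and its vertical coordinate. -/
theorem eq_of_vertCoord_eq (z : B.LocalSection) {y : B.TorusBundle 𝒜}
    (hy : B.torusProj 𝒜 y ∈ z.baseSet)
    {ξ η : TangentSpace (𝓘(ℝ, E).prod 𝓘(ℝ, Euc d)) y}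
    (h1 : mfderiv (𝓘(ℝ, E).prod 𝓘(ℝ, Euc d)) 𝓘(ℝ, E) (B.torusProj 𝒜) y ξ =
      mfderiv (𝓘(ℝ, E).prod 𝓘(ℝ, Euc d)) 𝓘(ℝ, E) (B.torusProj 𝒜) y η)
    (h2 : vertCoord z y ξ = vertCoord z y η) : ξ = η := by
  have hd := ((contMDiffAt_torusTriv (E := E) z hy).mdifferentiableAt (by simp)).hasMFDerivAt
  have ht : torusTriv 𝒜 z y ∈ (torusTriv 𝒜 z).target := (torusTriv 𝒜 z).map_source hy
  have hs := (((contMDiffOn_torusTriv_symm (E := E) z).contMDiffAt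
    ((torusTriv 𝒜 z).open_target.mem_nhds ht)).mdifferentiableAt (by simp)).hasMFDerivAt
  have hid : HasMFDerivAt (𝓘(ℝ, E).prod 𝓘(ℝ, Euc d)) (𝓘(ℝ, E).prod 𝓘(ℝ, Euc d))
      ((torusTriv 𝒜 z).toOpenPartialHomeomorph.symm ∘ torusTriv 𝒜 z) y
      (ContinuousLinearMap.id ℝ _) := by
    refine (hasMFDerivAt_id y).congr_of_eventuallyEq ?_
    filter_upwards [(torusTriv 𝒜 z).open_source.mem_nhds hy] with y' hy'
    exact (torusTriv 𝒜 z).left_inv hy'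
  have h := hasMFDerivAt_unique (hs.comp y hd) hid
  have h3 : mfderiv (𝓘(ℝ, E).prod 𝓘(ℝ, Euc d)) (𝓘(ℝ, E).prod 𝓘(ℝ, Euc d)) (torusTriv 𝒜 z) y ξ =
      mfderiv (𝓘(ℝ, E).prod 𝓘(ℝ, Euc d)) (𝓘(ℝ, E).prod 𝓘(ℝ, Euc d)) (torusTriv 𝒜 z) y η := by
    rw [mfderiv_torusTriv z hy]
    exact Prod.ext h1 h2
  have e1 := DFunLike.congr_fun h ξ
  have e2 := DFunLike.congr_fun h η
  rw [ContinuousLinearMap.comp_apply] at e1 e2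
  rw [h3] at e1
  exact e1.symm.trans e2

/-- The derivative at `τ` of the inclusion `τ ↦ [q, τ]` of the fibre containing `y = [q, τ]`, with
values transported to the tangent space at `y`. -/
def vertLift (q : B.Total) (y : B.TorusBundle 𝒜) (τ : Torus L) (h : Assoc.mk B 𝒜.homeo q τ = y) :
    Euc d →L[ℝ] TangentSpace (𝓘(ℝ, E).prod 𝓘(ℝ, Euc d)) y :=
  h ▸ mfderiv 𝓘(ℝ, Euc d) (𝓘(ℝ, E).prod 𝓘(ℝ, Euc d)) (Assoc.mk B 𝒜.homeo q) τ

theorem torusProj_mfderiv_vertLift {q : B.Total} {y : B.TorusBundle 𝒜} {τ : Torus L}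
    (h : Assoc.mk B 𝒜.homeo q τ = y) (η : Euc d) :
    mfderiv (𝓘(ℝ, E).prod 𝓘(ℝ, Euc d)) 𝓘(ℝ, E) (B.torusProj 𝒜) y (vertLift q y τ h η) = 0 := by
  subst h
  have h1 := (hasMFDerivAt_torusProj (E := E) (Assoc.mk B 𝒜.homeo q τ)).comp τ
    ((contMDiff_assocMk (E := E) q).mdifferentiable (by simp) τ).hasMFDerivAt
  have h2 : HasMFDerivAt 𝓘(ℝ, Euc d) 𝓘(ℝ, E) (B.torusProj 𝒜 ∘ Assoc.mk B 𝒜.homeo q) τ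
    (0 : TangentSpace 𝓘(ℝ, Euc d) τ →L[ℝ] TangentSpace 𝓘(ℝ, E) (B.proj q)) :=
    hasMFDerivAt_const (B.proj q) τ
  exact DFunLike.congr_fun (hasMFDerivAt_unique h1 h2) η

theorem vertCoord_vertLift (z : B.LocalSection) {q : B.Total} (hq : B.proj q ∈ z.baseSet)
    {y : B.TorusBundle 𝒜} {τ : Torus L} (h : Assoc.mk B 𝒜.homeo q τ = y) (η : Euc d) :
    vertCoord (E := E) z y (vertLift q y τ h η) = 𝒜.lin (div (z (B.proj q)) q) η := by
  subst h
  have h1 := (hasMFDerivAt_coord (E := E) z (y := Assoc.mk B 𝒜.homeo q τ) hq).comp τ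
    ((contMDiff_assocMk (E := E) q).mdifferentiable (by simp) τ).hasMFDerivAt
  have h2 := Torus.hasMFDerivAt_homeo 𝒜 (div (z (B.proj q)) q) τ
  have h3 : Assoc.coord (ρ := 𝒜.homeo) z ∘ Assoc.mk B 𝒜.homeo q =
      𝒜.homeo (div (z (B.proj q)) q) := funext fun τ => Assoc.coord_mk z hq τ
  rw [← h3] at h2
  exact DFunLike.congr_fun (hasMFDerivAt_unique h1 h2) η

theorem mfderiv_torusMk (q : B.Total) (v : Euc d) (η : Euc d) :
    mfderiv 𝓘(ℝ, Euc d) (𝓘(ℝ, E).prod 𝓘(ℝ, Euc d)) (B.torusMk 𝒜 q) v η =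
      vertLift (E := E) q (B.torusMk 𝒜 q v) (Torus.mk L v) rfl η := by
  have h1 := ((contMDiff_assocMk (E := E) (𝒜 := 𝒜) q).mdifferentiable (by simp)
    (Torus.mk L v)).hasMFDerivAt.comp v (Torus.hasMFDerivAt_mk v)
  exact DFunLike.congr_fun h1.mfderiv η

variable (B 𝒜) in
/-- The projection of `T_y Y` onto the vertical space along the vectors with zero vertical
coordinate. It is written in the chosen frame `sectionAt`, but does not depend on the frame, see
`vertCoord_canonicalVproj`. -/
def canonicalVproj (y : B.TorusBundle 𝒜) :
    TangentSpace (𝓘(ℝ, E).prod 𝓘(ℝ, Euc d)) y →L[ℝ] TangentSpace (𝓘(ℝ, E).prod 𝓘(ℝ, Euc d)) y :=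
  (vertLift (B.sectionAt (B.torusProj 𝒜 y) (B.torusProj 𝒜 y)) y
    (Assoc.coord (B.sectionAt (B.torusProj 𝒜 y)) y) (Assoc.mk_coord _ (mem_sectionAt _))).comp
    (vertCoord (B.sectionAt (B.torusProj 𝒜 y)) y)

theorem mfderiv_torusProj_canonicalVproj (y : B.TorusBundle 𝒜)
    (ξ : TangentSpace (𝓘(ℝ, E).prod 𝓘(ℝ, Euc d)) y) :
    mfderiv (𝓘(ℝ, E).prod 𝓘(ℝ, Euc d)) 𝓘(ℝ, E) (B.torusProj 𝒜) y (canonicalVproj B 𝒜 y ξ) = 0 :=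
  torusProj_mfderiv_vertLift _ _

theorem vertCoord_canonicalVproj (z : B.LocalSection) {y : B.TorusBundle 𝒜}
    (hy : B.torusProj 𝒜 y ∈ z.baseSet) (ξ : TangentSpace (𝓘(ℝ, E).prod 𝓘(ℝ, Euc d)) y) :
    vertCoord z y (canonicalVproj B 𝒜 y ξ) = vertCoord z y ξ := by
  have hm : B.torusProj 𝒜 y ∈ (B.sectionAt (B.torusProj 𝒜 y)).baseSet := mem_sectionAt _
  rw [vertCoord_eq_lin_vertCoord _ z hm hy, vertCoord_eq_lin_vertCoord _ z hm hy ξ]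
  congr 1
  have hp := (B.sectionAt (B.torusProj 𝒜 y)).proj_toFun _ hm
  refine (vertCoord_vertLift _ (by rw [hp]; exact hm) _ _).trans ?_
  rw [hp, div_self_eq_one, 𝒜.lin_one]
  rfl

theorem canonicalVproj_eq_self_iff (y : B.TorusBundle 𝒜)
    (ξ : TangentSpace (𝓘(ℝ, E).prod 𝓘(ℝ, Euc d)) y) :
    canonicalVproj B 𝒜 y ξ = ξ ↔
      ξ ∈ verticalSpace (𝓘(ℝ, E).prod 𝓘(ℝ, Euc d)) 𝓘(ℝ, E) (B.torusProj 𝒜) y := by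
  constructor
  · intro h
    rw [← h]
    exact mfderiv_torusProj_canonicalVproj y ξ
  · intro h
    refine eq_of_vertCoord_eq _ (mem_sectionAt _) ?_ (vertCoord_canonicalVproj _ (mem_sectionAt _) ξ)
    rw [mfderiv_torusProj_canonicalVproj]
    exact (LinearMap.mem_ker.1 h).symm

theorem canonicalVproj_eq_zero_iff (z : B.LocalSection) {y : B.TorusBundle 𝒜}
    (hy : B.torusProj 𝒜 y ∈ z.baseSet) (ξ : TangentSpace (𝓘(ℝ, E).prod 𝓘(ℝ, Euc d)) y) :
    canonicalVproj B 𝒜 y ξ = 0 ↔ vertCoord z y ξ = 0 := by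
  rw [← vertCoord_canonicalVproj z hy]
  constructor
  · intro h
    rw [h, map_zero]
  · intro h
    refine eq_of_vertCoord_eq z hy ?_ (by rw [h, map_zero])
    rw [mfderiv_torusProj_canonicalVproj, map_zero]

end VerticalCoordinate

end PrincipalBundle

/-! ### The canonical connection and its flatness -/

namespace PrincipalBundle

section CanonicalConnection

variable {P : Type*} [Group P] [TopologicalSpace P] [DiscreteTopology P]
  {d : ℕ} {L : Submodule ℤ (Euc d)} [DiscreteTopology L]
  {E : Type*} [NormedAddCommGroup E] [NormedSpace ℝ E]
  {X : Type*} [TopologicalSpace X] [ChartedSpace E X] [IsManifold 𝓘(ℝ, E) ∞ X]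
  {B : PrincipalBundle P X} {𝒜 : AffineTorusAction P L}

theorem isCanonical_iff
    {C : EhresmannConnection (𝓘(ℝ, E).prod 𝓘(ℝ, Euc d)) 𝓘(ℝ, E) (B.torusProj 𝒜)} :
    IsCanonical C ↔ ∀ (z : B.LocalSection) (y : B.TorusBundle 𝒜), B.torusProj 𝒜 y ∈ z.baseSet →
      ∀ ξ : TangentSpace (𝓘(ℝ, E).prod 𝓘(ℝ, Euc d)) y,
        C.vproj y ξ = 0 ↔ vertCoord z y ξ = 0 := by
  refine forall_congr' fun z => forall_congr' fun y => forall_congr' fun hy =>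
    forall_congr' fun ξ => ?_
  rw [mfderiv_torusTriv z hy]
  exact Iff.rfl

/-- A canonical connection has the projections `canonicalVproj`, since a projection is determined
by its kernel and its range. -/
theorem IsCanonical.vproj_eq
    {C : EhresmannConnection (𝓘(ℝ, E).prod 𝓘(ℝ, Euc d)) 𝓘(ℝ, E) (B.torusProj 𝒜)}
    (hC : IsCanonical C) (y : B.TorusBundle 𝒜) : C.vproj y = canonicalVproj B 𝒜 y := by
  have hm : B.torusProj 𝒜 y ∈ (B.sectionAt (B.torusProj 𝒜 y)).baseSet := mem_sectionAt _
  ext1 ξ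
  refine eq_of_vertCoord_eq _ hm ?_ ?_
  · rw [mfderiv_torusProj_canonicalVproj]
    have h : C.vproj y ξ ∈
        verticalSpace (𝓘(ℝ, E).prod 𝓘(ℝ, Euc d)) 𝓘(ℝ, E) (B.torusProj 𝒜) y := by
      rw [← C.range_vproj]
      exact LinearMap.mem_range_self _ ξ
    exact h
  · rw [vertCoord_canonicalVproj _ hm]
    have h : C.vproj y (ξ - C.vproj y ξ) = 0 := by
      rw [map_sub, C.vproj_vproj, sub_self]
    have h2 := (isCanonical_iff.1 hC _ y hm _).1 h
    rw [map_sub, sub_eq_zero] at h2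
    exact h2.symm

/-- The preferred charts of `Y` are products of a chart of `X` and a chart of the torus, in the
frame `sectionAt`. -/
theorem extChartAt_torusBundle_eq (y₀ : B.TorusBundle 𝒜) :
    (extChartAt (𝓘(ℝ, E).prod 𝓘(ℝ, Euc d)) y₀ : B.TorusBundle 𝒜 → E × Euc d) = fun y =>
      (extChartAt 𝓘(ℝ, E) (B.torusProj 𝒜 y₀) (B.torusProj 𝒜 y),
        chartAt (Euc d) (Assoc.coord (B.sectionAt (B.torusProj 𝒜 y₀)) y₀ : Torus L)
          (Assoc.coord (B.sectionAt (B.torusProj 𝒜 y₀)) y)) := by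
  funext y
  simp only [mfld_simps]
  rfl

theorem mem_of_mem_chartAt_source {y₀ y : B.TorusBundle 𝒜}
    (hy : y ∈ (chartAt (ModelProd E (Euc d)) y₀).source) :
    B.torusProj 𝒜 y ∈ (B.sectionAt (B.torusProj 𝒜 y₀)).baseSet ∧
    B.torusProj 𝒜 y ∈ (chartAt E (B.torusProj 𝒜 y₀)).source ∧
    Assoc.coord (B.sectionAt (B.torusProj 𝒜 y₀)) y ∈
      (chartAt (Euc d) (Assoc.coord (B.sectionAt (B.torusProj 𝒜 y₀)) y₀ : Torus L)).source :=
  hy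

/-- In the preferred charts of `Y` the vertical coordinate is the second component. -/
theorem hasMFDerivAt_extChartAt_torusBundle {y₀ y : B.TorusBundle 𝒜}
    (hy : y ∈ (chartAt (ModelProd E (Euc d)) y₀).source) :
    HasMFDerivAt (𝓘(ℝ, E).prod 𝓘(ℝ, Euc d)) 𝓘(ℝ, E × Euc d)
      (extChartAt (𝓘(ℝ, E).prod 𝓘(ℝ, Euc d)) y₀) y
      (((mfderiv 𝓘(ℝ, E) 𝓘(ℝ, E) (extChartAt 𝓘(ℝ, E) (B.torusProj 𝒜 y₀)) (B.torusProj 𝒜 y)).comp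
        (mfderiv (𝓘(ℝ, E).prod 𝓘(ℝ, Euc d)) 𝓘(ℝ, E) (B.torusProj 𝒜) y)).prod
          (vertCoord (E := E) (B.sectionAt (B.torusProj 𝒜 y₀)) y)) := by
  obtain ⟨h1, h2, h3⟩ := mem_of_mem_chartAt_source hy
  rw [extChartAt_torusBundle_eq]
  have hX : HasMFDerivAt 𝓘(ℝ, E) 𝓘(ℝ, E) (extChartAt 𝓘(ℝ, E) (B.torusProj 𝒜 y₀))
      (B.torusProj 𝒜 y) _ := (mdifferentiableAt_extChartAt h2).hasMFDerivAt
  have hT := (Torus.hasMFDerivAt_of_mem_atlas (chart_mem_atlas _ _) h3).comp y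
    (hasMFDerivAt_coord (E := E) _ h1)
  have hXY := hX.comp y (hasMFDerivAt_torusProj y)
  exact ⟨hXY.1.prodMk hT.1, HasFDerivWithinAt.prodMk hXY.2 hT.2⟩

theorem snd_mfderiv_extChartAt {y₀ y : B.TorusBundle 𝒜}
    (hy : y ∈ (chartAt (ModelProd E (Euc d)) y₀).source)
    (ξ : TangentSpace (𝓘(ℝ, E).prod 𝓘(ℝ, Euc d)) y) :
    (mfderiv (𝓘(ℝ, E).prod 𝓘(ℝ, Euc d)) 𝓘(ℝ, E × Euc d)
      (extChartAt (𝓘(ℝ, E).prod 𝓘(ℝ, Euc d)) y₀) y ξ : E × Euc d).2 =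
      vertCoord (B.sectionAt (B.torusProj 𝒜 y₀)) y ξ := by
  rw [(hasMFDerivAt_extChartAt_torusBundle hy).mfderiv]
  rfl

theorem mfderiv_extChartAt_canonicalVproj {y₀ y : B.TorusBundle 𝒜}
    (hy : y ∈ (chartAt (ModelProd E (Euc d)) y₀).source)
    (ξ : TangentSpace (𝓘(ℝ, E).prod 𝓘(ℝ, Euc d)) y) :
    (mfderiv (𝓘(ℝ, E).prod 𝓘(ℝ, Euc d)) 𝓘(ℝ, E × Euc d)
      (extChartAt (𝓘(ℝ, E).prod 𝓘(ℝ, Euc d)) y₀) y (canonicalVproj B 𝒜 y ξ) : E × Euc d) =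
      (0, vertCoord (B.sectionAt (B.torusProj 𝒜 y₀)) y ξ) := by
  refine Prod.ext ?_ ?_
  · rw [(hasMFDerivAt_extChartAt_torusBundle hy).mfderiv]
    have h := mfderiv_torusProj_canonicalVproj y ξ
    refine (congrArg (mfderiv 𝓘(ℝ, E) 𝓘(ℝ, E) (extChartAt 𝓘(ℝ, E) (B.torusProj 𝒜 y₀))
      (B.torusProj 𝒜 y)) h).trans (map_zero _)
  · rw [snd_mfderiv_extChartAt hy]
    exact vertCoord_canonicalVproj _ (mem_of_mem_chartAt_source hy).1 ξ

/-- In the tangent coordinates of the preferred charts, `canonicalVproj` is the constant projection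
`E × ℝ^d → 0 × ℝ^d`. -/
theorem contMDiff_canonicalVproj :
    ContMDiff (𝓘(ℝ, E).prod 𝓘(ℝ, Euc d))
      ((𝓘(ℝ, E).prod 𝓘(ℝ, Euc d)).prod 𝓘(ℝ, (E × Euc d) →L[ℝ] (E × Euc d))) ∞ fun y =>
        TotalSpace.mk' ((E × Euc d) →L[ℝ] (E × Euc d))
          (E := fun y : B.TorusBundle 𝒜 => TangentSpace (𝓘(ℝ, E).prod 𝓘(ℝ, Euc d)) y →L[ℝ]
            TangentSpace (𝓘(ℝ, E).prod 𝓘(ℝ, Euc d)) y) y (canonicalVproj B 𝒜 y) := by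
  intro y₀
  rw [contMDiffAt_hom_bundle]
  refine ⟨contMDiffAt_id, ?_⟩
  refine (contMDiffAt_const (c := (ContinuousLinearMap.inr ℝ E (Euc d)).comp
    (ContinuousLinearMap.snd ℝ E (Euc d)))).congr_of_eventuallyEq ?_
  filter_upwards [(chartAt (ModelProd E (Euc d)) y₀).open_source.mem_nhds (mem_chart_source _ y₀)]
    with y hy
  refine ContinuousLinearMap.ext fun a => ?_
  simp only [ContinuousLinearMap.inCoordinates]
  rw [TangentBundle.continuousLinearMapAt_trivializationAt hy,
    TangentBundle.symmL_trivializationAt hy]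
  have hy' : y ∈ (extChartAt (𝓘(ℝ, E).prod 𝓘(ℝ, Euc d)) y₀).source := by
    rwa [extChartAt_source]
  have h := DFunLike.congr_fun (mfderiv_extChartAt_comp_mfderivWithin_extChartAt_symm'
    (I := 𝓘(ℝ, E).prod 𝓘(ℝ, Euc d)) hy') a
  refine (mfderiv_extChartAt_canonicalVproj hy _).trans ?_
  rw [← snd_mfderiv_extChartAt hy]
  exact congrArg (fun b : E × Euc d => ((0 : E), b.2)) h

variable (E B 𝒜) in
/-- The canonical connection on the torus bundle. -/
def canonicalConnection :
    EhresmannConnection (𝓘(ℝ, E).prod 𝓘(ℝ, Euc d)) 𝓘(ℝ, E) (B.torusProj 𝒜) where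
  vproj := canonicalVproj B 𝒜
  vproj_vproj y ξ := (canonicalVproj_eq_self_iff y _).2 (mfderiv_torusProj_canonicalVproj y ξ)
  range_vproj y := by
    ext ξ
    constructor
    · rintro ⟨η, rfl⟩
      exact mfderiv_torusProj_canonicalVproj y η
    · exact fun h => ⟨ξ, (canonicalVproj_eq_self_iff y ξ).2 h⟩
  contMDiff_vproj := contMDiff_canonicalVproj

theorem isCanonical_canonicalConnection : IsCanonical (canonicalConnection E B 𝒜) :=
  isCanonical_iff.2 fun z _ hy ξ => canonicalVproj_eq_zero_iff z hy ξ

theorem existsUnique_isCanonical :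
    ∃! C : EhresmannConnection (𝓘(ℝ, E).prod 𝓘(ℝ, Euc d)) 𝓘(ℝ, E) (B.torusProj 𝒜),
      IsCanonical C :=
  ⟨canonicalConnection E B 𝒜, isCanonical_canonicalConnection, fun _ hC =>
    EhresmannConnection.ext (funext fun y => hC.vproj_eq y)⟩

end CanonicalConnection

section Flatness

/-- The Lie bracket of vector fields with vanishing second component has vanishing second
component. -/
theorem snd_lieBracketWithin_eq_zero {F G : Type*} [NormedAddCommGroup F] [NormedSpace ℝ F]
    [NormedAddCommGroup G] [NormedSpace ℝ G] {V W : F × G → F × G} {s : Set (F × G)}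
    {a : F × G} (hs : s = univ)
    (hV : ∀ᶠ b in 𝓝 a, (V b).2 = 0) (hW : ∀ᶠ b in 𝓝 a, (W b).2 = 0) :
    (VectorField.lieBracketWithin ℝ V W s a).2 = 0 := by
  have key : ∀ {U : F × G → F × G}, (∀ᶠ b in 𝓝 a, (U b).2 = 0) → ∀ c, (fderiv ℝ U a c).2 = 0 := by
    intro U hU c
    -- If `U` is not differentiable at `a`, then `fderiv ℝ U a` is zero by convention.
    by_cases hd : DifferentiableAt ℝ U a
    · have h1 := hd.hasFDerivAt.snd
      have h2 : HasFDerivAt (fun b => (U b).2) (0 : F × G →L[ℝ] G) a :=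
        (hasFDerivAt_const (0 : G) a).congr_of_eventuallyEq hU
      exact DFunLike.congr_fun (h1.unique h2) c
    · rw [fderiv_zero_of_not_differentiableAt hd]
      rfl
  rw [hs, VectorField.lieBracketWithin_univ, VectorField.lieBracket, Prod.snd_sub, key hV, key hW, sub_self]

variable {P : Type*} [Group P] [TopologicalSpace P] [DiscreteTopology P]
  {d : ℕ} {L : Submodule ℤ (Euc d)} [DiscreteTopology L]
  {E : Type*} [NormedAddCommGroup E] [NormedSpace ℝ E]
  {X : Type*} [TopologicalSpace X] [ChartedSpace E X] [IsManifold 𝓘(ℝ, E) ∞ X]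
  {B : PrincipalBundle P X} {𝒜 : AffineTorusAction P L}

/-- In the preferred charts, horizontal fields have vanishing second component. -/
theorem snd_mpullbackWithin_extChartAt_symm (y₀ : B.TorusBundle 𝒜)
    {V : (y : B.TorusBundle 𝒜) → TangentSpace (𝓘(ℝ, E).prod 𝓘(ℝ, Euc d)) y}
    {O : Set (B.TorusBundle 𝒜)} (hO : IsOpen O) (hy₀ : y₀ ∈ O)
    (hV : ∀ y ∈ O, canonicalVproj B 𝒜 y (V y) = 0) :
    ∀ᶠ a in 𝓝 (extChartAt (𝓘(ℝ, E).prod 𝓘(ℝ, Euc d)) y₀ y₀),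
      (VectorField.mpullbackWithin 𝓘(ℝ, E × Euc d) (𝓘(ℝ, E).prod 𝓘(ℝ, Euc d))
        (extChartAt (𝓘(ℝ, E).prod 𝓘(ℝ, Euc d)) y₀).symm V
        (range (𝓘(ℝ, E).prod 𝓘(ℝ, Euc d))) a : E × Euc d).2 = 0 := by
  have hc := continuousAt_extChartAt_symm (I := 𝓘(ℝ, E).prod 𝓘(ℝ, Euc d)) y₀
  filter_upwards [extChartAt_target_mem_nhds (I := 𝓘(ℝ, E).prod 𝓘(ℝ, Euc d)) y₀,
    hc.eventually_mem (by rw [extChartAt_to_inv]; exact hO.mem_nhds hy₀)] with a ha haO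
  set y := (extChartAt (𝓘(ℝ, E).prod 𝓘(ℝ, Euc d)) y₀).symm a
  have hy : y ∈ (chartAt (ModelProd E (Euc d)) y₀).source := by
    rw [← extChartAt_source (𝓘(ℝ, E).prod 𝓘(ℝ, Euc d))]
    exact (extChartAt _ y₀).map_target ha
  have h1 := mfderivWithin_extChartAt_symm_comp_mfderiv_extChartAt
    (I := 𝓘(ℝ, E).prod 𝓘(ℝ, Euc d)) ha
  have h2 := mfderiv_extChartAt_comp_mfderivWithin_extChartAt_symm
    (I := 𝓘(ℝ, E).prod 𝓘(ℝ, Euc d)) ha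
  have h3 := ContinuousLinearMap.inverse_eq h1 h2
  rw [VectorField.mpullbackWithin_apply, h3]
  refine (snd_mfderiv_extChartAt hy (V y)).trans ?_
  exact (canonicalVproj_eq_zero_iff _ (mem_of_mem_chartAt_source hy).1 _).1 (hV y haO)

theorem IsCanonical.isFlat
    {C : EhresmannConnection (𝓘(ℝ, E).prod 𝓘(ℝ, Euc d)) 𝓘(ℝ, E) (B.torusProj 𝒜)}
    (hC : IsCanonical C) : C.IsFlat := by
  intro O hO V W _ _ hV hW y₀ hy₀
  have key : ∀ y ξ, ξ ∈ C.horizontal y ↔ canonicalVproj B 𝒜 y ξ = 0 := by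
    intro y ξ
    rw [← hC.vproj_eq y]
    exact Iff.rfl
  have hV' := snd_mpullbackWithin_extChartAt_symm y₀ hO hy₀ fun y hy => (key y _).1 (hV y hy)
  have hW' := snd_mpullbackWithin_extChartAt_symm y₀ hO hy₀ fun y hy => (key y _).1 (hW y hy)
  have hs : y₀ ∈ (chartAt (ModelProd E (Euc d)) y₀).source := mem_chart_source _ _
  rw [key, canonicalVproj_eq_zero_iff (B.sectionAt (B.torusProj 𝒜 y₀)) (mem_sectionAt _),
    ← snd_mfderiv_extChartAt hs, ← VectorField.mlieBracketWithin_univ,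
    VectorField.mlieBracketWithin_apply]
  have hinv : (mfderiv (𝓘(ℝ, E).prod 𝓘(ℝ, Euc d)) 𝓘(ℝ, E × Euc d)
      (extChartAt (𝓘(ℝ, E).prod 𝓘(ℝ, Euc d)) y₀) y₀).IsInvertible :=
    isInvertible_mfderiv_extChartAt (mem_extChartAt_source y₀)
  have hL := snd_lieBracketWithin_eq_zero
    (s := (extChartAt (𝓘(ℝ, E).prod 𝓘(ℝ, Euc d)) y₀).symm ⁻¹' univ ∩
      range (𝓘(ℝ, E).prod 𝓘(ℝ, Euc d))) (by simp) hV' hW'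
  exact (congrArg Prod.snd (DFunLike.congr_fun hinv.self_comp_inverse _)).trans hL

end Flatness

end PrincipalBundle

/-! ### Vertical spaces, covariant differentials and local lifts -/

namespace PrincipalBundle

section VerticalIdentification

variable {P : Type*} [Group P] [TopologicalSpace P] [DiscreteTopology P]
  {d : ℕ} {L : Submodule ℤ (Euc d)} [DiscreteTopology L]
  {E : Type*} [NormedAddCommGroup E] [NormedSpace ℝ E]
  {X : Type*} [TopologicalSpace X] [ChartedSpace E X] [IsManifold 𝓘(ℝ, E) ∞ X]
  {B : PrincipalBundle P X} {𝒜 : AffineTorusAction P L}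

theorem vecTriv_snd_eq_lin (z z' : B.LocalSection) {x : X} (hx : x ∈ z.baseSet)
    (hx' : x ∈ z'.baseSet) (e : B.VecFiber 𝒜 x) :
    (vecTriv z' ⟨x, e⟩).2 = 𝒜.lin (div (z' x) (z x)) (vecTriv z ⟨x, e⟩).2 := by
  obtain ⟨e, rfl⟩ := e
  exact coord_eq_coord (ρ := 𝒜.linHomeo) z z' hx hx'

theorem vecTriv_vecMk (z : B.LocalSection) {x : X} (hx : x ∈ z.baseSet) {q : B.Total}
    (hq : B.proj q = x) (ξ : Euc d) :
    (vecTriv z ⟨x, vecMk B 𝒜 q hq ξ⟩).2 = 𝒜.lin (div (z x) q) ξ := by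
  subst hq
  exact Assoc.coord_mk (ρ := 𝒜.linHomeo) z hx ξ

/-- The vertical space at `y` is `ℝ^d` by the vertical coordinate of a local section of `Q`. -/
def verticalCoordEquiv (z : B.LocalSection) (y : B.TorusBundle 𝒜)
    (hy : B.torusProj 𝒜 y ∈ z.baseSet) :
    verticalSpace (𝓘(ℝ, E).prod 𝓘(ℝ, Euc d)) 𝓘(ℝ, E) (B.torusProj 𝒜) y ≃L[ℝ] Euc d :=
  ContinuousLinearEquiv.equivOfInverse
    ((vertCoord z y).comp (Submodule.subtypeL _))
    ((vertLift (E := E) (z (B.torusProj 𝒜 y)) y (Assoc.coord z y)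
      (Assoc.mk_coord z hy)).codRestrict _ fun η => torusProj_mfderiv_vertLift _ η)
    (fun ξ => Subtype.ext (eq_of_vertCoord_eq z hy
      ((torusProj_mfderiv_vertLift _ _).trans (LinearMap.mem_ker.1 ξ.2).symm) (by
        have hp := z.proj_toFun _ hy
        refine (vertCoord_vertLift z (hp.symm ▸ hy) _ _).trans ?_
        rw [hp, div_self_eq_one, 𝒜.lin_one]
        rfl)))
    (fun η => by
      have hp := z.proj_toFun _ hy
      refine (vertCoord_vertLift z (hp.symm ▸ hy) _ _).trans ?_
      rw [hp, div_self_eq_one, 𝒜.lin_one])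

/-- The identification of the fibre of `Q ×_P ℝ^d` with the vertical space at `y`: a vector and its
image have the same coordinates with respect to a local section of `Q`. -/
def vertEquiv (y : B.TorusBundle 𝒜) : B.VecFiber 𝒜 (B.torusProj 𝒜 y) ≃L[ℝ]
    verticalSpace (𝓘(ℝ, E).prod 𝓘(ℝ, Euc d)) 𝓘(ℝ, E) (B.torusProj 𝒜) y :=
  ((vecTriv (B.sectionAt (B.torusProj 𝒜 y))).continuousLinearEquivAt ℝ (B.torusProj 𝒜 y)
    (mem_sectionAt _)).trans
    (verticalCoordEquiv (B.sectionAt (B.torusProj 𝒜 y)) y (mem_sectionAt _)).symm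

theorem vertCoord_vertEquiv (z : B.LocalSection) {y : B.TorusBundle 𝒜}
    (hy : B.torusProj 𝒜 y ∈ z.baseSet) (e : B.VecFiber 𝒜 (B.torusProj 𝒜 y)) :
    vertCoord (E := E) z y (vertEquiv y e).1 = (vecTriv z ⟨B.torusProj 𝒜 y, e⟩).2 := by
  have hm : B.torusProj 𝒜 y ∈ (B.sectionAt (B.torusProj 𝒜 y)).baseSet := mem_sectionAt _
  rw [vertCoord_eq_lin_vertCoord _ z hm hy, vecTriv_snd_eq_lin _ z hm hy]
  congr 1
  exact (verticalCoordEquiv (E := E) (B.sectionAt (B.torusProj 𝒜 y)) y hm).apply_symm_apply _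

theorem torusProj_vertEquiv (y : B.TorusBundle 𝒜) (e : B.VecFiber 𝒜 (B.torusProj 𝒜 y)) :
    mfderiv (𝓘(ℝ, E).prod 𝓘(ℝ, Euc d)) 𝓘(ℝ, E) (B.torusProj 𝒜) y (vertEquiv y e).1 = 0 :=
  LinearMap.mem_ker.1 (vertEquiv y e).2

theorem vertEquiv_torusMk (q : B.Total) (v ξ : Euc d) :
    (vertEquiv (E := E) (B.torusMk 𝒜 q v) (B.vecMk 𝒜 q rfl ξ)).1 =
      mfderiv 𝓘(ℝ, Euc d) (𝓘(ℝ, E).prod 𝓘(ℝ, Euc d)) (B.torusMk 𝒜 q) v ξ := by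
  have hm : B.torusProj 𝒜 (B.torusMk 𝒜 q v) ∈ (B.sectionAt (B.proj q)).baseSet :=
    mem_sectionAt (B.proj q)
  rw [mfderiv_torusMk]
  refine eq_of_vertCoord_eq (B.sectionAt (B.proj q)) hm ?_ ?_
  · rw [torusProj_vertEquiv]
    exact (torusProj_mfderiv_vertLift _ ξ).symm
  · rw [vertCoord_vertEquiv (B.sectionAt (B.proj q)) hm]
    exact (vecTriv_vecMk _ hm rfl ξ).trans (vertCoord_vertLift _ hm rfl ξ).symm

theorem VecFiber.cast_injective {x x' : X} (h : x = x') :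
    Function.Injective (VecFiber.cast (B := B) (𝒜 := 𝒜) h) := by
  intro e e' he
  exact Subtype.ext (congrArg (fun a : B.VecFiber 𝒜 x' => a.1) he)

end VerticalIdentification

section CovariantDifferential

variable {P : Type*} [Group P] [TopologicalSpace P] [DiscreteTopology P]
  {d : ℕ} {L : Submodule ℤ (Euc d)} [DiscreteTopology L]
  {E : Type*} [NormedAddCommGroup E] [NormedSpace ℝ E]
  {X : Type*} [TopologicalSpace X] [ChartedSpace E X] [IsManifold 𝓘(ℝ, E) ∞ X]
  {B : PrincipalBundle P X} {𝒜 : AffineTorusAction P L} {σ : X → B.TorusBundle 𝒜}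

/-- The covariant differential of `σ` at `x` as a homomorphism into the fibre of `Q ×_P ℝ^d`, written
in the chosen frame `sectionAt x`; see `vecTriv_covDiff` for the other frames. -/
def covDiff (σ : X → B.TorusBundle 𝒜) (x : X) :
    TangentSpace 𝓘(ℝ, E) x →L[ℝ] B.VecFiber 𝒜 x :=
  (((vecTriv (𝒜 := 𝒜) (B.sectionAt x)).continuousLinearEquivAt ℝ x
    (mem_sectionAt x)).symm : Euc d →L[ℝ] B.VecFiber 𝒜 x).comp
    ((vertCoord (B.sectionAt x) (σ x)).comp
      (mfderiv 𝓘(ℝ, E) (𝓘(ℝ, E).prod 𝓘(ℝ, Euc d)) σ x))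

theorem vecTriv_covDiff (z : B.LocalSection) {x : X} (hx : x ∈ z.baseSet)
    (hσ : B.torusProj 𝒜 (σ x) = x) (w : TangentSpace 𝓘(ℝ, E) x) :
    (vecTriv z ⟨x, covDiff σ x w⟩).2 =
      vertCoord z (σ x) (mfderiv 𝓘(ℝ, E) (𝓘(ℝ, E).prod 𝓘(ℝ, Euc d)) σ x w) := by
  have hm : x ∈ (B.sectionAt x).baseSet := mem_sectionAt x
  rw [vertCoord_eq_lin_vertCoord (B.sectionAt x) z (by rwa [hσ]) (by rwa [hσ]),
    vecTriv_snd_eq_lin (B.sectionAt x) z hm hx, hσ]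
  congr 1
  exact ((vecTriv (𝒜 := 𝒜) (B.sectionAt x)).continuousLinearEquivAt ℝ x hm).apply_symm_apply _

/-- `covDiff` corresponds under `vertEquiv` to the vertical part of the derivative of `σ`. -/
theorem vertEquiv_covDiff {x : X} (hσ : B.torusProj 𝒜 (σ x) = x) (w : TangentSpace 𝓘(ℝ, E) x) :
    (vertEquiv (E := E) (σ x) (VecFiber.cast hσ.symm (covDiff σ x w))).1 =
      canonicalVproj B 𝒜 (σ x) (mfderiv 𝓘(ℝ, E) (𝓘(ℝ, E).prod 𝓘(ℝ, Euc d)) σ x w) := by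
  have hm : B.torusProj 𝒜 (σ x) ∈ (B.sectionAt x).baseSet := hσ.symm ▸ mem_sectionAt x
  refine eq_of_vertCoord_eq (B.sectionAt x) hm ?_ ?_
  · rw [torusProj_vertEquiv, mfderiv_torusProj_canonicalVproj]
  · rw [vertCoord_vertEquiv _ hm, vertCoord_canonicalVproj _ hm,
      ← vecTriv_covDiff _ (mem_sectionAt x) hσ]
    rfl

theorem contMDiffAt_coord_comp (hs : ContMDiff 𝓘(ℝ, E) (𝓘(ℝ, E).prod 𝓘(ℝ, Euc d)) ∞ σ)
    (hσ : ∀ x, B.torusProj 𝒜 (σ x) = x) (z : B.LocalSection) {x : X} (hx : x ∈ z.baseSet) :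
    ContMDiffAt 𝓘(ℝ, E) 𝓘(ℝ, Euc d) ∞ (fun y => (Assoc.coord z (σ y) : Torus L)) x :=
  (contMDiffAt_coord z (by rwa [hσ])).comp x (hs x)

theorem mfderiv_coord_comp (hs : ContMDiff 𝓘(ℝ, E) (𝓘(ℝ, E).prod 𝓘(ℝ, Euc d)) ∞ σ)
    (hσ : ∀ x, B.torusProj 𝒜 (σ x) = x) (z : B.LocalSection) {x : X} (hx : x ∈ z.baseSet)
    (w : TangentSpace 𝓘(ℝ, E) x) :
    (mfderiv 𝓘(ℝ, E) 𝓘(ℝ, Euc d) (fun y => (Assoc.coord z (σ y) : Torus L)) x w : Euc d) =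
      vertCoord z (σ x) (mfderiv 𝓘(ℝ, E) (𝓘(ℝ, E).prod 𝓘(ℝ, Euc d)) σ x w) :=
  DFunLike.congr_fun ((hasMFDerivAt_coord z (by rwa [hσ])).comp x
    (hs.mdifferentiable (by simp) x).hasMFDerivAt).mfderiv w

/-- The charts of the torus provide local lifts. -/
theorem exists_isLocalLift (hs : ContMDiff 𝓘(ℝ, E) (𝓘(ℝ, E).prod 𝓘(ℝ, Euc d)) ∞ σ)
    (hσ : ∀ x, B.torusProj 𝒜 (σ x) = x) (z : B.LocalSection) {x : X} (hx : x ∈ z.baseSet) :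
    ∃ W u, x ∈ W ∧ IsLocalLift z σ W u := by
  set s : X → Torus L := fun y => Assoc.coord z (σ y)
  have hc : ContinuousOn s z.baseSet := fun y hy =>
    (contMDiffAt_coord_comp hs hσ z hy).continuousAt.continuousWithinAt
  set e := chartAt (Euc d) (s x)
  refine ⟨z.baseSet ∩ s ⁻¹' e.source, fun y => e (s y), ⟨hx, mem_chart_source (Euc d) (s x)⟩, ?_⟩
  exact
    { isOpen := hc.isOpen_inter_preimage z.isOpen_baseSet e.open_source
      subset := inter_subset_left
      continuousOn := e.continuousOn.comp (hc.mono inter_subset_left) fun y hy => hy.2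
      mk_eq := fun y hy => Torus.mk_chart (chart_mem_atlas _ _) hy.2 }

variable {z : B.LocalSection} {W : Set X} {u : X → Euc d}

theorem IsLocalLift.eventually_mk_eq (hu : IsLocalLift z σ W u) {x : X} (hx : x ∈ W) :
    ∀ᶠ y in 𝓝 x, Torus.mk L (u y) = Assoc.coord z (σ y) := by
  filter_upwards [hu.isOpen.mem_nhds hx] with y hy
  exact hu.mk_eq y hy

theorem IsLocalLift.contMDiffAt (hu : IsLocalLift z σ W u)
    (hs : ContMDiff 𝓘(ℝ, E) (𝓘(ℝ, E).prod 𝓘(ℝ, Euc d)) ∞ σ)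
    (hσ : ∀ x, B.torusProj 𝒜 (σ x) = x) {x : X} (hx : x ∈ W) :
    ContMDiffAt 𝓘(ℝ, E) 𝓘(ℝ, Euc d) ∞ u x :=
  Torus.contMDiffAt_lift (contMDiffAt_coord_comp hs hσ z (hu.subset hx))
    (hu.continuousOn.continuousAt (hu.isOpen.mem_nhds hx)) (hu.eventually_mk_eq hx)

/-- In an admissible trivialization the covariant differential is the differential of a lift. -/
theorem IsLocalLift.vecTriv_covDiff (hu : IsLocalLift z σ W u)
    (hs : ContMDiff 𝓘(ℝ, E) (𝓘(ℝ, E).prod 𝓘(ℝ, Euc d)) ∞ σ)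
    (hσ : ∀ x, B.torusProj 𝒜 (σ x) = x) {x : X} (hx : x ∈ W) (w : TangentSpace 𝓘(ℝ, E) x) :
    (vecTriv z ⟨x, covDiff σ x w⟩).2 = mfderiv 𝓘(ℝ, E) 𝓘(ℝ, Euc d) u x w := by
  rw [PrincipalBundle.vecTriv_covDiff z (hu.subset hx) (hσ x),
    ← mfderiv_coord_comp hs hσ z (hu.subset hx)]
  exact (Torus.mfderiv_lift ((hu.contMDiffAt hs hσ hx).mdifferentiableAt (by simp))
    (hu.eventually_mk_eq hx) w).symm

/-- In the coordinates around `x₀` the covariant differential is the differential of a smooth local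
lift, hence it is smooth. -/
theorem contMDiff_covDiff (hs : ContMDiff 𝓘(ℝ, E) (𝓘(ℝ, E).prod 𝓘(ℝ, Euc d)) ∞ σ)
    (hσ : ∀ x, B.torusProj 𝒜 (σ x) = x) :
    ContMDiff 𝓘(ℝ, E) (𝓘(ℝ, E).prod 𝓘(ℝ, E →L[ℝ] Euc d)) ∞ (fun x =>
      Bundle.TotalSpace.mk' (E →L[ℝ] Euc d)
        (E := fun x => TangentSpace 𝓘(ℝ, E) x →L[ℝ] B.VecFiber 𝒜 x) x (covDiff σ x)) := by
  intro x₀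
  rw [contMDiffAt_hom_bundle]
  refine ⟨contMDiffAt_id, ?_⟩
  obtain ⟨W, u, hx₀, hu⟩ := exists_isLocalLift hs hσ (B.sectionAt x₀) (mem_sectionAt x₀)
  refine ((hu.contMDiffAt hs hσ hx₀).mfderiv_const (m := ∞) (by simp)).congr_of_eventuallyEq ?_
  filter_upwards [hu.isOpen.mem_nhds hx₀] with x hx
  refine ContinuousLinearMap.ext fun a => ?_
  have h1 : ∀ b : TangentSpace 𝓘(ℝ, E) x,
      (trivializationAt (Euc d) (B.VecFiber 𝒜) x₀).continuousLinearMapAt ℝ x (covDiff σ x b) =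
        mfderiv 𝓘(ℝ, E) 𝓘(ℝ, Euc d) u x b := by
    intro b
    have hb : x ∈ (trivializationAt (Euc d) (B.VecFiber 𝒜) x₀).baseSet := hu.subset hx
    rw [← hu.vecTriv_covDiff hs hσ hx, Trivialization.continuousLinearMapAt_apply,
      Trivialization.linearMapAt_apply, if_pos hb]
    rfl
  simp only [inTangentCoordinates, ContinuousLinearMap.inCoordinates, id,
    TangentBundle.continuousLinearMapAt_model_space]
  exact h1 _

/-- On the overlap of two frames the transition element and the lattice shift are locally constant,
so the lifts differ by a locally constant affine isometry. -/
theorem IsLocalLift.exists_transition (hs : ContMDiff 𝓘(ℝ, E) (𝓘(ℝ, E).prod 𝓘(ℝ, Euc d)) ∞ σ)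
    (hσ : ∀ x, B.torusProj 𝒜 (σ x) = x) {z' : B.LocalSection} {W' : Set X} {u' : X → Euc d}
    (hu : IsLocalLift z σ W u) (hu' : IsLocalLift z' σ W' u') {x : X} (hx : x ∈ W ∩ W') :
    ∃ g : P, ∃ l ∈ L,
      (∀ᶠ y in 𝓝 x, z' y = z y <• g ∧
        (torusTriv 𝒜 z' (σ y)).2 = 𝒜.act g⁻¹ (torusTriv 𝒜 z (σ y)).2 ∧
        u' y = (𝒜.lin g).symm (u y) + 𝒜.shift g⁻¹ + l) ∧
      ∀ w : TangentSpace 𝓘(ℝ, E) x,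
        mfderiv 𝓘(ℝ, E) 𝓘(ℝ, Euc d) u' x w =
          (𝒜.lin g).symm (mfderiv 𝓘(ℝ, E) 𝓘(ℝ, Euc d) u x w) := by
  set g := div (z x) (z' x)
  have hz : z.baseSet ∈ 𝓝 x := z.isOpen_baseSet.mem_nhds (hu.subset hx.1)
  have hz' : z'.baseSet ∈ 𝓝 x := z'.isOpen_baseSet.mem_nhds (hu'.subset hx.2)
  have hg : ∀ᶠ y in 𝓝 x, z' y = z y <• g ∧
      (torusTriv 𝒜 z' (σ y)).2 = 𝒜.act g⁻¹ (torusTriv 𝒜 z (σ y)).2 := by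
    have h := eventually_div_eq z' z ⟨hu'.subset hx.2, hu.subset hx.1⟩
    rw [nhdsWithin_eq_nhds.2 (Filter.inter_mem hz' hz)] at h
    filter_upwards [h, hz, hz'] with y hy hzy hzy'
    have hp : B.proj (z y) = B.proj (z' y) := by rw [z.proj_toFun y hzy, z'.proj_toFun y hzy']
    refine ⟨by rw [← smul_div hp, hy], ?_⟩
    have h2 : Assoc.proj B 𝒜.homeo (σ y) = y := hσ y
    have h1 := coord_eq_coord (ρ := 𝒜.homeo) z z' (y := σ y) (by rwa [h2]) (by rwa [h2])
    rw [h2, div_symm hp, hy] at h1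
    exact h1
  have hcu := hu.continuousOn.continuousAt (hu.isOpen.mem_nhds hx.1)
  have hcu' := hu'.continuousOn.continuousAt (hu'.isOpen.mem_nhds hx.2)
  obtain ⟨l, hl, hev⟩ := Torus.eventually_eq_add_of_mk_eq (L := L) hcu'
    (g := fun y => (𝒜.lin g).symm (u y) + 𝒜.shift g⁻¹)
    (((𝒜.lin g).symm.continuous.continuousAt.comp hcu).add continuousAt_const) (by
      filter_upwards [hg, hu.isOpen.mem_nhds hx.1, hu'.isOpen.mem_nhds hx.2] with y hy hW hW'
      rw [hu'.mk_eq y hW', hy.2, ← hu.mk_eq y hW, 𝒜.act_mk, 𝒜.lin_inv])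
  refine ⟨g, l, hl, ?_, fun w => ?_⟩
  · filter_upwards [hg, hev] with y h1 h2
    exact ⟨h1.1, h1.2, h2⟩
  · have hd := ((hu.contMDiffAt hs hσ hx.1).mdifferentiableAt (by simp)).hasMFDerivAt
    have ha : HasMFDerivAt 𝓘(ℝ, Euc d) 𝓘(ℝ, Euc d)
        (fun v => (𝒜.lin g).symm v + 𝒜.shift g⁻¹ + l) (u x)
        ((𝒜.lin g).symm.toContinuousLinearEquiv : Euc d →L[ℝ] Euc d) :=
      ((((𝒜.lin g).symm.toContinuousLinearEquiv.hasFDerivAt (x := u x)).add_const _).add_const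
        _).hasMFDerivAt
    exact DFunLike.congr_fun ((ha.comp x hd).congr_of_eventuallyEq hev).mfderiv w

end CovariantDifferential

end PrincipalBundle

end CrystalBundle

end

open CrystalBundle PrincipalBundle in
theorem proposition4p3 {d : ℕ} (L : Submodule ℤ (Euc d)) [DiscreteTopology L] [IsZLattice ℝ L]
    {P : Type*} [Group P] [TopologicalSpace P] [DiscreteTopology P] (𝒜 : AffineTorusAction P L)
    {E : Type*} [NormedAddCommGroup E] [NormedSpace ℝ E] [FiniteDimensional ℝ E]
    {X : Type*} [TopologicalSpace X] [ChartedSpace E X] [IsManifold 𝓘(ℝ, E) ∞ X]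
    (B : PrincipalBundle P X) :
    -- `Y → X` is a smooth fibre bundle, trivialized by the admissible local trivializations
    (ContMDiff (𝓘(ℝ, E).prod 𝓘(ℝ, Euc d)) 𝓘(ℝ, E) ∞ (B.torusProj 𝒜) ∧
      ∀ z : B.LocalSection,
        ContMDiffOn (𝓘(ℝ, E).prod 𝓘(ℝ, Euc d)) (𝓘(ℝ, E).prod 𝓘(ℝ, Euc d)) ∞
          (torusTriv 𝒜 z) (torusTriv 𝒜 z).source ∧
        ContMDiffOn (𝓘(ℝ, E).prod 𝓘(ℝ, Euc d)) (𝓘(ℝ, E).prod 𝓘(ℝ, Euc d)) ∞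
          (torusTriv 𝒜 z).toOpenPartialHomeomorph.symm (torusTriv 𝒜 z).target) ∧
    -- the canonical connection exists and is unique
    (∃! Γ₀ : EhresmannConnection (𝓘(ℝ, E).prod 𝓘(ℝ, Euc d)) 𝓘(ℝ, E) (B.torusProj 𝒜),
      IsCanonical Γ₀) ∧
    ∀ Γ₀ : EhresmannConnection (𝓘(ℝ, E).prod 𝓘(ℝ, Euc d)) 𝓘(ℝ, E) (B.torusProj 𝒜),
      IsCanonical Γ₀ →
      -- it is flat
      Γ₀.IsFlat ∧
      -- the natural identification of the vertical spaces with the fibres of `Q ×_P ℝ^d`, under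
      -- which `[q, ξ]` corresponds to the derivative of `w ↦ [q, [w]]` at `v` in direction `ξ`
      ∃ Φ : ∀ y : B.TorusBundle 𝒜, B.VecFiber 𝒜 (B.torusProj 𝒜 y) ≃L[ℝ]
          verticalSpace (𝓘(ℝ, E).prod 𝓘(ℝ, Euc d)) 𝓘(ℝ, E) (B.torusProj 𝒜) y,
        (∀ (q : B.Total) (v ξ : Euc d),
          (Φ (B.torusMk 𝒜 q v) (B.vecMk 𝒜 q rfl ξ)).1 =
            mfderiv 𝓘(ℝ, Euc d) (𝓘(ℝ, E).prod 𝓘(ℝ, Euc d)) (B.torusMk 𝒜 q) v ξ) ∧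
        ∀ (σ : X → B.TorusBundle 𝒜),
          ContMDiff 𝓘(ℝ, E) (𝓘(ℝ, E).prod 𝓘(ℝ, Euc d)) ∞ σ →
          ∀ hσ : ∀ x, B.torusProj 𝒜 (σ x) = x,
          ∃! θ : ∀ x : X, TangentSpace 𝓘(ℝ, E) x →L[ℝ] B.VecFiber 𝒜 x,
            -- `θ` is the covariant differential of `σ`
            (∀ (x : X) (w : TangentSpace 𝓘(ℝ, E) x),
              (Φ (σ x) (VecFiber.cast (hσ x).symm (θ x w))).1 =
                Γ₀.covariantDifferential σ x w) ∧
            -- it is a smooth section of `T*X ⊗ (Q ×_P ℝ^d) = Hom(TX, Q ×_P ℝ^d)`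
            ContMDiff 𝓘(ℝ, E) (𝓘(ℝ, E).prod 𝓘(ℝ, E →L[ℝ] Euc d)) ∞ (fun x =>
              Bundle.TotalSpace.mk' (E →L[ℝ] Euc d)
                (E := fun x => TangentSpace 𝓘(ℝ, E) x →L[ℝ] B.VecFiber 𝒜 x) x (θ x)) ∧
            -- local lifts exist and represent `θ` through their ordinary differential
            (∀ z : B.LocalSection,
              (∀ x ∈ z.baseSet, ∃ W u, x ∈ W ∧ IsLocalLift z σ W u) ∧
              ∀ W u, IsLocalLift z σ W u →
                ContMDiffOn 𝓘(ℝ, E) 𝓘(ℝ, Euc d) ∞ u W ∧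
                ∀ x ∈ W, ∀ w : TangentSpace 𝓘(ℝ, E) x,
                  (vecTriv z ⟨x, θ x w⟩).2 = mfderiv 𝓘(ℝ, E) 𝓘(ℝ, Euc d) u x w) ∧
            -- on overlaps the affine and lattice shifts are locally constant, and the differentials
            -- of the local lifts transform by the linear point-group action
            (∀ (z z' : B.LocalSection) (W W' : Set X) (u u' : X → Euc d),
              IsLocalLift z σ W u → IsLocalLift z' σ W' u' → ∀ x ∈ W ∩ W',
              ∃ g : P, ∃ l ∈ L,
                (∀ᶠ y in 𝓝 x, z' y = z y <• g ∧
                  (torusTriv 𝒜 z' (σ y)).2 = 𝒜.act g⁻¹ (torusTriv 𝒜 z (σ y)).2 ∧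
                  u' y = (𝒜.lin g).symm (u y) + 𝒜.shift g⁻¹ + l) ∧
                ∀ w : TangentSpace 𝓘(ℝ, E) x,
                  mfderiv 𝓘(ℝ, E) 𝓘(ℝ, Euc d) u' x w =
                    (𝒜.lin g).symm (mfderiv 𝓘(ℝ, E) 𝓘(ℝ, Euc d) u x w)) := by
  refine ⟨⟨contMDiff_torusProj, fun z => ⟨contMDiffOn_torusTriv z, contMDiffOn_torusTriv_symm z⟩⟩,
    existsUnique_isCanonical, fun Γ₀ hΓ => ⟨hΓ.isFlat, vertEquiv, vertEquiv_torusMk,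
      fun σ hs hσ => ⟨covDiff σ, ⟨fun x w => ?_, contMDiff_covDiff hs hσ, fun z =>
        ⟨fun x hx => exists_isLocalLift hs hσ z hx, fun W u hu =>
          ⟨fun x hx => (hu.contMDiffAt hs hσ hx).contMDiffWithinAt,
            fun x hx w => hu.vecTriv_covDiff hs hσ hx w⟩⟩,
        fun z z' W W' u u' hu hu' x hx => hu.exists_transition hs hσ hu' hx⟩,
        fun θ hθ => ?_⟩⟩⟩
  · rw [vertEquiv_covDiff (hσ x), EhresmannConnection.covariantDifferential, hΓ.vproj_eq]
    rfl
  · funext x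
    refine ContinuousLinearMap.ext fun w => ?_
    apply VecFiber.cast_injective (hσ x).symm
    apply (vertEquiv (E := E) (σ x)).injective
    apply Subtype.ext
    rw [hθ.1 x w, vertEquiv_covDiff (hσ x), EhresmannConnection.covariantDifferential, hΓ.vproj_eq]
    rfl
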